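/- **Setting.** An election is a pair $(C,V)$: a finite set $C$ of candidates (identified by names) and a finite multiset $V$ of votes over $C$. An election system $\mathcal E$ maps each election to a (possibly empty) subset of $C$, the winners. If $C'\subseteq C$, then $(C',V)$ means that each vote is masked down to $C'$. In plurality (resp. veto) the votes are linear orders of $C$ and a candidate gets a point from each vote that ranks it first (resp. that does not rank it last); in approval voting a vote is a bit vector over $C$ and a candidate gets a point from each vote that approves of it. In each of the three systems the winners are the candidates with the maximal score. **Control types.** There are 11 control actions. In each one, $p\in C$ is the focus candidate. - AC (input $C$, disjoint set $A$, votes $V$ over $C\cup A$, $p$, $k\in\mathbb N$): choose $A'\subseteq A$ with $|A'|\le k$; the final election is $(C\cup A',V)$. UAC: the same without $k$ and without the bound. - DC (input $C,V,p,k$): choose $C'\subseteq C\setminus\{p\}$ with $|C'|\le k$; the final election is $(C\setminus C',V)$. DV (input $C,V,p,k$): delete at most $k$ votes from $V$. - AV (input $C$, votes $V,W$ over $C$, $p$, $k$): add at most $k$ votes from $W$ to $V$. - PV-$t$, PC-$t$, RPC-$t$ with $t\in\{\mathrm{TE},\mathrm{TP}\}$ (input $C,V,p$). PV: choose a partition $V=V_1\cup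 V_2$; the survivors of $(C,V_1)$ and of $(C,V_2)$ meet in the final election, with votes $V$. RPC: choose a partition $C=C_1\cup C_2$; the survivors of $(C_1,V)$ and of $(C_2,V)$ meet in the final election, with votes $V$. PC: choose a partition $C=C_1\cup C_2$; the survivors of $(C_1,V)$ meet all of $C_2$ in the final election, with votes $V$. Parts may be empty. Under TP all the winners of a subelection survive, under TE only a unique winner does. Each action is combined with a goal and a winner model. In the constructive types (prefix CC) some choice has to make $p$ a winner of the final election (suffix NUW) or its unique winner (suffix UW); in the destructive types (prefix DC) some choice has to make $p$ not a winner (NUW) or not a unique winner (UW). This gives 44 control types $\mathcal T$. Let $\mathcal E\text{-}\mathcal T$ be the set of yes-instances. Two types are compatible if their inputs have the same fields; there are 322 unordered pairs of distinct compatible types. For an input $\tilde I$ without focus candidate let $f_{\mathcal E\text{-}\mathcal T}(\tilde I)$ be the set of the $c$ for which $\tilde I$ with focus candidate $c$ is in $\mathcal E\text{-}\mathcal T$. Compatible types $\mathcal T,\mathcal T'$ collapse for $\mathcal E$ if $\mathcal E\text{-}\mathcal T=\mathcal E\text{-}\mathcal T'$, and otherwise they separate. We write $\mathcal T\subsetneq\mathcal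 T'$ if $f_{\mathcal E\text{-}\mathcal T}(\tilde I)\subseteq f_{\mathcal E\text{-}\mathcal T'}(\tilde I)$ for all $\tilde I$ and $f_{\mathcal E\text{-}\mathcal T'}(\tilde I)\setminus f_{\mathcal E\text{-}\mathcal T}(\tilde I)\ne\emptyset$ for some $\tilde I$. They are incomparable if they separate and neither $\mathcal T\subsetneq\mathcal T'$ nor $\mathcal T'\subsetneq\mathcal T$. **Notation.** $D_{TE}=\{$DC-RPC-TE-NUW, DC-RPC-TE-UW, DC-PC-TE-NUW, DC-PC-TE-UW$\}$, $D_N=\{$DC-RPC-TP-NUW, DC-PC-TP-NUW$\}$, $D_U=\{$DC-RPC-TP-UW, DC-PC-TP-UW$\}$, $P_{TE}=\{$DC-PV-TE-NUW, DC-PV-TE-UW$\}$, $P_{TP}=\{$DC-PV-TP-NUW, DC-PV-TP-UW$\}$; and for $t\in\{\mathrm{TE},\mathrm{TP}\}$ and $w\in\{\mathrm{UW},\mathrm{NUW}\}$, $K_{t,w}=\{$CC-RPC-$t$-$w$, CC-PC-$t$-$w\}$. For sets of types, $X\subsetneq Y$ means $\mathcal T\subsetneq\mathcal T'$ for all $\mathcal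 T\in X$, $\mathcal T'\in Y$. **Theorem.** For every election system, all types in $D_{TE}$ collapse with each other, and so do all types in $D_N$ (seven collapsing pairs). For plurality, veto and approval, the distinct compatible pairs are classified as follows. The collapsing pairs are exactly the pairs inside one of the listed classes. Among the remaining pairs, the strict containments are exactly: CC-$a$-UW $\subsetneq$ CC-$a$-NUW and DC-$a$-NUW $\subsetneq$ DC-$a$-UW for each action $a$ (whenever the two types are not in the same class), and the listed ones. Every other pair is incomparable. 1. *Plurality.* Classes: $D_{TE}$, $D_N$. Strict containments: $D_N\subsetneq D_U\cup D_{TE}$; $D_U\subsetneq D_{TE}$. In total 7 collapses and 315 separations, of which 38 are strict containments and 277 are incomparabilities. 2. *Veto.* Classes: $D_{TE}$, $D_N$, $P_{TE}$. Strict containments: those listed for plurality, and $P_{TP}\cup D_{TE}\cup D_U\cup D_N\subsetneq P_{TE}$. In total 8 collapses and 314 separations, of which 57 are strict containments and 257 are incomparabilities. 3. *Approval.* Classes: $D_{TE}\cup D_U$, $D_N$, $P_{TE}$, $K_{TP,UW}$, $K_{TP,NUW}$, $K_{TE,UW}$, $K_{TE,NUW}$. Strict containments: $D_N\subsetneq D_{TE}\cup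 D_U\cup P_{TP}\cup P_{TE}$; $D_{TE}\cup D_U\subsetneq\{$DC-PV-TP-UW$\}\cup P_{TE}$; $P_{TP}\subsetneq P_{TE}$; $K_{TP,UW}\subsetneq K_{TP,NUW}\cup K_{TE,UW}\cup K_{TE,NUW}\cup\{$CC-PV-TE-UW, CC-PV-TE-NUW, CC-PV-TP-UW, CC-PV-TP-NUW$\}$; $K_{TP,NUW}\subsetneq K_{TE,NUW}\cup\{$CC-PV-TP-NUW$\}$; $K_{TE,UW}\subsetneq K_{TE,NUW}$; $\{$DC-DC-NUW$\}\subsetneq\{$DC-DV-NUW, DC-DV-UW$\}$; $\{$DC-DC-UW$\}\subsetneq\{$DC-DV-UW$\}$. In total 21 collapses and 301 separations, of which 88 are strict containments and 213 are incomparabilities. -/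

import Mathlib

/-! ### Elections and election systems -/

/-- An election system with its vote type. Candidates are identified by names, and names are natural
numbers. `IsBallot C b` says that `b` is a vote over the candidate set `C`; `mask C b` is the vote
`b` masked down to the candidates in `C`; `winners C V` is the set of winners of the election
`(C, V)`, where `V` is a finite multiset of votes over `C`. Having no winner is allowed. -/
structure ElectionSystem where
  Ballot : Type
  IsBallot : Finset ℕ → Ballot → Prop
  mask : Finset ℕ → Ballot → Ballot
  winners : Finset ℕ → Multiset Ballot → Finset ℕ
  isBallot_mask : ∀ {C D : Finset ℕ} {b : Ballot}, D ⊆ C → IsBallot C b → IsBallot D (mask D b)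
  mask_self : ∀ {C : Finset ℕ} {b : Ballot}, IsBallot C b → mask C b = b
  winners_subset : ∀ (C : Finset ℕ) (V : Multiset Ballot), winners C V ⊆ C

/-- The winners of the election with candidate set `C` and votes `V`, the votes being over a possibly
larger candidate set and masked down to `C`. -/
def ElectionSystem.elect (E : ElectionSystem) (C : Finset ℕ) (V : Multiset E.Ballot) : Finset ℕ :=
  E.winners C (V.map (E.mask C))

/-- The candidates of maximal score. -/
def argmaxScore (C : Finset ℕ) (score : ℕ → ℕ) : Finset ℕ :=
  C.filter (fun c => ∀ d ∈ C, score d ≤ score c)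

/-- A linear ordering of the finite set `C`, written as the duplicate-free list of the members of
`C`, most preferred candidate first. -/
def IsLinearBallot (C : Finset ℕ) (v : List ℕ) : Prop :=
  v.Nodup ∧ v.toFinset = C

theorem IsLinearBallot.filter {C D : Finset ℕ} {v : List ℕ} (h : D ⊆ C) (hv : IsLinearBallot C v) :
    IsLinearBallot D (v.filter (fun c => decide (c ∈ D))) := by
  refine ⟨hv.1.filter _, ?_⟩
  ext c
  have hc : c ∈ v ↔ c ∈ C := by rw [← hv.2, List.mem_toFinset]
  simp only [List.mem_toFinset, List.mem_filter, decide_eq_true_eq]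
  exact ⟨fun x => x.2, fun x => ⟨hc.2 (h x), x⟩⟩

theorem IsLinearBallot.filter_self {C : Finset ℕ} {v : List ℕ} (hv : IsLinearBallot C v) :
    v.filter (fun c => decide (c ∈ C)) = v := by
  rw [List.filter_eq_self]
  intro c hc
  rw [decide_eq_true_eq, ← hv.2, List.mem_toFinset]
  exact hc

/-- The election system over linear orders in which the candidates of maximal score win, where
`score V c` is the score of `c` when the votes are `V`. -/
def ElectionSystem.ofLinearScore (score : Multiset (List ℕ) → ℕ → ℕ) : ElectionSystem where
  Ballot := List ℕ
  IsBallot := IsLinearBallot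
  mask C v := v.filter (fun c => decide (c ∈ C))
  winners C V := argmaxScore C (score V)
  isBallot_mask h hv := hv.filter h
  mask_self hv := hv.filter_self
  winners_subset _ _ := Finset.filter_subset _ _

/-- Plurality: one point for each vote that ranks the candidate first. -/
def plurality : ElectionSystem :=
  ElectionSystem.ofLinearScore (fun V c => V.countP (fun v => v.head? = some c))

/-- Veto: one point for each vote that does not rank the candidate last. -/
def veto : ElectionSystem :=
  ElectionSystem.ofLinearScore (fun V c => V.countP (fun v => v.getLast? ≠ some c))

/-- Approval voting: a vote is a bit vector indexed by the candidates, given as the set of the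
approved candidates; one point for each vote that approves of the candidate. -/
def approval : ElectionSystem where
  Ballot := Finset ℕ
  IsBallot C v := v ⊆ C
  mask C v := v ∩ C
  winners C V := argmaxScore C (fun c => V.countP (fun v => c ∈ v))
  isBallot_mask _ _ := Finset.inter_subset_right
  mask_self hv := Finset.inter_eq_left.2 hv
  winners_subset _ _ := Finset.filter_subset _ _

/-! ### The 44 control types -/

/-- Ties eliminate, ties promote. -/
inductive TieRule
  | TE
  | TP
  deriving DecidableEq

/-- The 11 control actions: partition of voters, partition of candidates, run-off partition of
candidates (each with either tie rule), adding candidates, unlimited adding of candidates, deleting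
candidates, adding voters, deleting voters. -/
inductive ControlAction
  | PV (t : TieRule)
  | PC (t : TieRule)
  | RPC (t : TieRule)
  | AC
  | UAC
  | DC
  | AV
  | DV
  deriving DecidableEq

/-- Unique-winner and nonunique-winner model. -/
inductive WinnerModel
  | UW
  | NUW
  deriving DecidableEq

inductive Goal
  | constructive
  | destructive
  deriving DecidableEq

structure ControlType where
  goal : Goal
  action : ControlAction
  model : WinnerModel
  deriving DecidableEq

/-- Constructive control. -/
def cc (a : ControlAction) (m : WinnerModel) : ControlType := ⟨.constructive, a, m⟩

/-- Destructive control. -/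
def dc (a : ControlAction) (m : WinnerModel) : ControlType := ⟨.destructive, a, m⟩

/-- The five kinds of input fields. -/
inductive InputKind
  | partition
  | addCandidates
  | addCandidatesUnlimited
  | delete
  | addVoters
  deriving DecidableEq

def ControlAction.inputKind : ControlAction → InputKind
  | .PV _ => .partition
  | .PC _ => .partition
  | .RPC _ => .partition
  | .AC => .addCandidates
  | .UAC => .addCandidatesUnlimited
  | .DC => .delete
  | .DV => .delete
  | .AV => .addVoters

/-- Two control types are compatible if their inputs have the same fields. -/
def Compatible (T T' : ControlType) : Prop :=
  T.action.inputKind = T'.action.inputKind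

/-- An input with the focus candidate removed: candidates `C`, votes `V`, spoiler candidates `A`,
spoiler votes `W`, limit `k`. -/
inductive ReducedInput (B : Type)
  | partition (C : Finset ℕ) (V : Multiset B)
  | addCandidates (C A : Finset ℕ) (V : Multiset B) (k : ℕ)
  | addCandidatesUnlimited (C A : Finset ℕ) (V : Multiset B)
  | delete (C : Finset ℕ) (V : Multiset B) (k : ℕ)
  | addVoters (C : Finset ℕ) (V W : Multiset B) (k : ℕ)

/-- An input: a reduced input together with the focus candidate. -/
structure Input (B : Type) where
  reduced : ReducedInput B
  focus : ℕ

def ReducedInput.inflate {B : Type} (R : ReducedInput B) (p : ℕ) : Input B := ⟨R, p⟩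

def ReducedInput.candidates {B : Type} : ReducedInput B → Finset ℕ
  | .partition C _ => C
  | .addCandidates C _ _ _ => C
  | .addCandidatesUnlimited C _ _ => C
  | .delete C _ _ => C
  | .addVoters C _ _ _ => C

/-- The votes are votes over the right candidate set, and spoiler candidates are not already
candidates. -/
def ReducedInput.WellFormed (E : ElectionSystem) : ReducedInput E.Ballot → Prop
  | .partition C V => ∀ v ∈ V, E.IsBallot C v
  | .addCandidates C A V _ => Disjoint C A ∧ ∀ v ∈ V, E.IsBallot (C ∪ A) v
  | .addCandidatesUnlimited C A V => Disjoint C A ∧ ∀ v ∈ V, E.IsBallot (C ∪ A) v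
  | .delete C V _ => ∀ v ∈ V, E.IsBallot C v
  | .addVoters C V W _ => (∀ v ∈ V, E.IsBallot C v) ∧ ∀ v ∈ W, E.IsBallot C v

/-- An input is well formed if its reduced form is and the focus candidate is a candidate. -/
def Input.WellFormed (E : ElectionSystem) (I : Input E.Ballot) : Prop :=
  I.reduced.WellFormed E ∧ I.focus ∈ I.reduced.candidates

/-- Those members of the set `W` of winners of a subelection that survive the tie-handling rule. -/
def TieRule.survivors : TieRule → Finset ℕ → Finset ℕ
  | .TP, W => W
  | .TE, W => if W.card = 1 then W else ∅

/-- The pairs (candidate set, votes) of the final elections that a chair who uses the control action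
can bring about from a reduced input when the focus candidate is `p`. -/
def finalElections (E : ElectionSystem) (p : ℕ) :
    ControlAction → ReducedInput E.Ballot → Set (Finset ℕ × Multiset E.Ballot)
  | .PV t, .partition C V =>
      {e | ∃ V₁ V₂ : Multiset E.Ballot, V₁ + V₂ = V ∧
        e = (t.survivors (E.elect C V₁) ∪ t.survivors (E.elect C V₂), V)}
  | .PC t, .partition C V =>
      {e | ∃ C₁ C₂ : Finset ℕ, C₁ ∪ C₂ = C ∧ Disjoint C₁ C₂ ∧
        e = (t.survivors (E.elect C₁ V) ∪ C₂, V)}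
  | .RPC t, .partition C V =>
      {e | ∃ C₁ C₂ : Finset ℕ, C₁ ∪ C₂ = C ∧ Disjoint C₁ C₂ ∧
        e = (t.survivors (E.elect C₁ V) ∪ t.survivors (E.elect C₂ V), V)}
  | .AC, .addCandidates C A V k =>
      {e | ∃ A' : Finset ℕ, A' ⊆ A ∧ A'.card ≤ k ∧ e = (C ∪ A', V)}
  | .UAC, .addCandidatesUnlimited C A V =>
      {e | ∃ A' : Finset ℕ, A' ⊆ A ∧ e = (C ∪ A', V)}
  | .DC, .delete C V k =>
      {e | ∃ C' : Finset ℕ, C' ⊆ C ∧ C'.card ≤ k ∧ p ∉ C' ∧ e = (C \ C', V)}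
  | .DV, .delete C V k =>
      {e | ∃ V' R : Multiset E.Ballot, V' + R = V ∧ V'.card ≤ k ∧ e = (C, R)}
  | .AV, .addVoters C V W k =>
      {e | ∃ W' : Multiset E.Ballot, W' ≤ W ∧ W'.card ≤ k ∧ e = (C, V + W')}
  | _, _ => ∅

/-- `p` is a winner (nonunique-winner model) or the only winner (unique-winner model). -/
def WinnerModel.Wins : WinnerModel → Finset ℕ → ℕ → Prop
  | .NUW, W, p => p ∈ W
  | .UW, W, p => W = {p}

/-- The goal of the chair regarding the focus candidate `p` is reached when the winner set is `W`. -/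
def ControlType.GoalMet (T : ControlType) (W : Finset ℕ) (p : ℕ) : Prop :=
  match T.goal with
  | .constructive => T.model.Wins W p
  | .destructive => ¬ T.model.Wins W p

/-- The control problem, as the set of its yes instances. -/
def controlProblem (E : ElectionSystem) (T : ControlType) : Set (Input E.Ballot) :=
  {I | I.WellFormed E ∧
    ∃ e ∈ finalElections E I.focus T.action I.reduced, T.GoalMet (E.elect e.1 e.2) I.focus}

/-! ### Collapses and separations -/

/-- The set of the candidates for which control succeeds on a reduced input. -/
def successSet (E : ElectionSystem) (T : ControlType) (R : ReducedInput E.Ballot) : Set ℕ :=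
  {c | R.inflate c ∈ controlProblem E T}

def Collapse (E : ElectionSystem) (T T' : ControlType) : Prop :=
  controlProblem E T = controlProblem E T'

def Separate (E : ElectionSystem) (T T' : ControlType) : Prop :=
  controlProblem E T ≠ controlProblem E T'

/-- Always contained, and on some reduced input properly. -/
def StrictlyContained (E : ElectionSystem) (T T' : ControlType) : Prop :=
  (∀ R : ReducedInput E.Ballot, successSet E T R ⊆ successSet E T' R) ∧
    ∃ R : ReducedInput E.Ballot, (successSet E T' R \ successSet E T R).Nonempty

def Incomparable (E : ElectionSystem) (T T' : ControlType) : Prop :=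
  Separate E T T' ∧ ¬ StrictlyContained E T T' ∧ ¬ StrictlyContained E T' T

/-- The possible entries of a classification table. -/
inductive Entry
  | collapse
  | strictSubset
  | strictSuperset
  | incomparable
  deriving DecidableEq

/-- The entry `r` is right for the pair `T`, `T'`. -/
def Entry.Holds (E : ElectionSystem) (T T' : ControlType) : Entry → Prop
  | .collapse => Collapse E T T'
  | .strictSubset => Separate E T T' ∧ StrictlyContained E T T'
  | .strictSuperset => Separate E T T' ∧ StrictlyContained E T' T
  | .incomparable => Incomparable E T T'

/-- The unordered pairs of distinct compatible control types that are in the relation `P`, in at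
least one of the two orders. -/
def compatiblePairs (P : ControlType → ControlType → Prop) : Set (Sym2 ControlType) :=
  {z | ∃ T T' : ControlType, z = s(T, T') ∧ T ≠ T' ∧ Compatible T T' ∧ P T T'}

/-! ### The classification tables -/

/-- The data of a classification table. Types in the same member of `classes` collapse; `below` lists
pairs of sets of types such that each type in the first set is strictly contained in each type in
the second. -/
structure ClassTable where
  classes : List (List ControlType)
  below : List (List ControlType × List ControlType)

def ClassTable.sameClass (K : ClassTable) (T T' : ControlType) : Bool :=
  K.classes.any (fun c => decide (T ∈ c ∧ T' ∈ c))

/-- The two winner models of one control action: a constructive type in the unique-winner model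
below its nonunique-winner variant, and the other way round for a destructive type. -/
def winnerModelBelow (T T' : ControlType) : Bool :=
  decide ((T = cc T.action .UW ∧ T' = cc T.action .NUW) ∨
    (T = dc T.action .NUW ∧ T' = dc T.action .UW))

def ClassTable.isBelow (K : ClassTable) (T T' : ControlType) : Bool :=
  winnerModelBelow T T' || K.below.any (fun b => decide (T ∈ b.1 ∧ T' ∈ b.2))

/-- The entry of the table for a pair of distinct compatible control types. -/
def ClassTable.entry (K : ClassTable) (T T' : ControlType) : Entry :=
  if K.sameClass T T' then .collapse
  else if K.isBelow T T' then .strictSubset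
  else if K.isBelow T' T then .strictSuperset
  else .incomparable

section Tables

open TieRule ControlAction WinnerModel

/-- DC-RPC-TE-NUW, DC-RPC-TE-UW, DC-PC-TE-NUW, DC-PC-TE-UW. -/
def destructiveTE : List ControlType :=
  [dc (RPC TE) NUW, dc (RPC TE) UW, dc (PC TE) NUW, dc (PC TE) UW]

/-- DC-RPC-TP-NUW, DC-PC-TP-NUW. -/
def destructiveTPNUW : List ControlType := [dc (RPC TP) NUW, dc (PC TP) NUW]

/-- DC-RPC-TP-UW, DC-PC-TP-UW. -/
def destructiveTPUW : List ControlType := [dc (RPC TP) UW, dc (PC TP) UW]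

/-- DC-PV-TE-NUW, DC-PV-TE-UW. -/
def destructivePVTE : List ControlType := [dc (PV TE) NUW, dc (PV TE) UW]

/-- DC-PV-TP-NUW, DC-PV-TP-UW. -/
def destructivePVTP : List ControlType := [dc (PV TP) NUW, dc (PV TP) UW]

/-- CC-RPC-TP-UW, CC-PC-TP-UW. -/
def constructiveTPUW : List ControlType := [cc (RPC TP) UW, cc (PC TP) UW]

/-- CC-RPC-TP-NUW, CC-PC-TP-NUW. -/
def constructiveTPNUW : List ControlType := [cc (RPC TP) NUW, cc (PC TP) NUW]

/-- CC-RPC-TE-UW, CC-PC-TE-UW. -/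
def constructiveTEUW : List ControlType := [cc (RPC TE) UW, cc (PC TE) UW]

/-- CC-RPC-TE-NUW, CC-PC-TE-NUW. -/
def constructiveTENUW : List ControlType := [cc (RPC TE) NUW, cc (PC TE) NUW]

/-- The seven collapsing pairs that hold for every election system. -/
def generalClasses : List (List ControlType) := [destructiveTE, destructiveTPNUW]

/-- The general strict containments other than those between the two winner models. -/
def generalBelow : List (List ControlType × List ControlType) :=
  [(destructiveTPNUW, destructiveTPUW ++ destructiveTE), (destructiveTPUW, destructiveTE)]

def pluralityTable : ClassTable where
  classes := generalClasses
  below := generalBelow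

def vetoTable : ClassTable where
  classes := generalClasses ++ [destructivePVTE]
  below := generalBelow ++
    [(destructivePVTP ++ destructiveTE ++ destructiveTPUW ++ destructiveTPNUW, destructivePVTE)]

def approvalTable : ClassTable where
  classes := [destructiveTE ++ destructiveTPUW, destructiveTPNUW, destructivePVTE,
    constructiveTPUW, constructiveTPNUW, constructiveTEUW, constructiveTENUW]
  below :=
    [(destructiveTPNUW, destructiveTE ++ destructiveTPUW ++ destructivePVTP ++ destructivePVTE),
      (destructiveTE ++ destructiveTPUW, [dc (PV TP) UW] ++ destructivePVTE),
      (destructivePVTP, destructivePVTE),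
      (constructiveTPUW, constructiveTPNUW ++ constructiveTEUW ++ constructiveTENUW ++
        [cc (PV TE) UW, cc (PV TE) NUW, cc (PV TP) UW, cc (PV TP) NUW]),
      (constructiveTPNUW, constructiveTENUW ++ [cc (PV TP) NUW]),
      (constructiveTEUW, constructiveTENUW),
      ([dc DC NUW], [dc DV NUW, dc DV UW]),
      ([dc DC UW], [dc DV UW])]

end Tables

/-!
The theorem is a finite table of containments `controlProblem E T ⊆ controlProblem E T'`: two types
collapse, are strictly contained or are incomparable according to which of the two containments
between them hold. Each entry thus comes down to proving the containments that the table claims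
(`ClassTable.le`), and to refuting, by an input, those that it denies.

*Containments.* Passing from the unique-winner to the nonunique-winner model weakens a constructive
goal and strengthens a destructive one. A destructive partition of candidates with ties eliminating
succeeds exactly if `p` fails to be the only winner of some subelection `(D, V)` with `p ∈ D ⊆ C`,
since the chair can make `D` one side of the partition (`solvable_dc_TE_iff`); with ties promoting
and in the nonunique-winner model, exactly if `p` loses some `(D, V)` (`solvable_dc_TP_NUW_iff`).
This gives everything that holds for every election system.

Under veto and approval, DC-PV-TE is governed by the existence of a partition of the votes in
which `p` is the only winner of neither half (`HasLosingSplit`). Under veto such a partition always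
exists if `p` has two rivals `x` and `y`: put the votes that rank `x` last into one half, where
nobody vetoes `y`, and the others into the other half, where nobody vetoes `x`
(`veto_hasLosingSplit`).

Under approval, scores do not depend on which other candidates take part, so (unique) winners remain
(unique) winners among fewer candidates (`approval_wins_mono`). Destructive candidate control is
therefore useless, and so is a constructive partition of candidates with ties promoting
(`approval_solvable_cc_TP_iff`). With ties eliminating, the best partition is `p` against all
others, in the hope that the others eliminate each other (`approval_solvable_cc_TE_iff`).

*Refutations.* A denied containment is refuted by one of a few small inputs. `PointRule.succeeds`
computes, on lists, whether a control action succeeds on such an input, by running through all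
partitions, additions or deletions; `PointRule.succeeds_iff` says that it is right. The kernel then
evaluates it on the witnesses, and `ClassTable.RefutedBy` checks that these cover all denied
containments. The numbers of pairs are read off the tables (`ncard_compatiblePairs`).
-/

/-! ### Final elections of the partition actions -/

theorem ElectionSystem.elect_subset (E : ElectionSystem) (C : Finset ℕ) (V : Multiset E.Ballot) :
    E.elect C V ⊆ C :=
  E.winners_subset _ _

theorem TieRule.survivors_subset (t : TieRule) (W : Finset ℕ) : t.survivors W ⊆ W := by
  cases t
  · change (if W.card = 1 then W else ∅) ⊆ W
    split_ifs
    · exact subset_rfl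
    · exact Finset.empty_subset _
  · exact subset_rfl

theorem TieRule.mem_survivors_TE {W : Finset ℕ} {p : ℕ} :
    p ∈ TieRule.TE.survivors W ↔ W = {p} := by
  change p ∈ (if W.card = 1 then W else ∅) ↔ W = {p}
  split_ifs with h
  · obtain ⟨a, rfl⟩ := Finset.card_eq_one.1 h
    simp [eq_comm]
  · simp only [Finset.notMem_empty, false_iff]
    rintro rfl
    exact h (Finset.card_singleton p)

theorem TieRule.mem_survivors_singleton (t : TieRule) (p : ℕ) : p ∈ t.survivors {p} := by
  cases t <;> simp [TieRule.survivors]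

theorem WinnerModel.wins_singleton (m : WinnerModel) (p : ℕ) : m.Wins {p} p := by
  cases m <;> simp [WinnerModel.Wins]

theorem WinnerModel.Wins.mem {m : WinnerModel} {W : Finset ℕ} {p : ℕ} (h : m.Wins W p) :
    p ∈ W := by
  cases m
  · rw [show W = {p} from h]
    exact Finset.mem_singleton_self p
  · exact h

/-- The control action can reach the goal on the partition input `(C, V)` with focus candidate `p`;
this is `controlProblem` without its well-formedness conditions. -/
def PartitionSolvable (E : ElectionSystem) (T : ControlType) (C : Finset ℕ)
    (V : Multiset E.Ballot) (p : ℕ) : Prop :=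
  ∃ e ∈ finalElections E p T.action (.partition C V), T.GoalMet (E.elect e.1 e.2) p

theorem finalElections_eq_empty {E : ElectionSystem} {p : ℕ} {a : ControlAction}
    {R : ReducedInput E.Ballot} (ha : a.inputKind = .partition)
    (hR : ∀ C V, R ≠ .partition C V) : finalElections E p a R = ∅ := by
  cases a <;> first | (exact absurd ha (by decide)) | skip
  all_goals
    cases R <;> first | (exact absurd rfl (hR _ _)) | rfl

theorem controlProblem_subset_of_partition {E : ElectionSystem} {T T' : ControlType}
    (hT : T.action.inputKind = .partition)
    (h : ∀ C V p, p ∈ C → PartitionSolvable E T C V p → PartitionSolvable E T' C V p) :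
    controlProblem E T ⊆ controlProblem E T' := by
  rintro ⟨R, p⟩ ⟨hw, hs⟩
  refine ⟨hw, ?_⟩
  by_cases hR : ∀ C V, R ≠ .partition C V
  · obtain ⟨e, he, -⟩ := hs
    rw [finalElections_eq_empty hT hR] at he
    exact he.elim
  · push Not at hR
    obtain ⟨C, V, rfl⟩ := hR
    exact h C V p hw.2 hs

/-- Final elections of a partition action have the original votes, and their candidates come from
the original candidate set. -/
theorem finalElections_partition_le {E : ElectionSystem} {p : ℕ} {a : ControlAction}
    {C : Finset ℕ} {V : Multiset E.Ballot} {e : Finset ℕ × Multiset E.Ballot}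
    (he : e ∈ finalElections E p a (.partition C V)) : e.1 ⊆ C ∧ e.2 = V := by
  have hs (t : TieRule) (D : Finset ℕ) (U : Multiset E.Ballot) : t.survivors (E.elect D U) ⊆ D :=
    (t.survivors_subset _).trans (E.elect_subset _ _)
  cases a with
  | PV t =>
    obtain ⟨V₁, V₂, -, rfl⟩ := he
    exact ⟨Finset.union_subset (hs t _ _) (hs t _ _), rfl⟩
  | PC t =>
    obtain ⟨C₁, C₂, rfl, -, rfl⟩ := he
    exact ⟨Finset.union_subset_union_left (hs t _ _), rfl⟩
  | RPC t =>
    obtain ⟨C₁, C₂, rfl, -, rfl⟩ := he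
    exact ⟨Finset.union_subset_union (hs t _ _) (hs t _ _), rfl⟩
  | AC => exact he.elim
  | UAC => exact he.elim
  | DC => exact he.elim
  | AV => exact he.elim
  | DV => exact he.elim

/-! ### Containments that hold for every election system -/

theorem cc_UW_subset_NUW (E : ElectionSystem) (a : ControlAction) :
    controlProblem E (cc a .UW) ⊆ controlProblem E (cc a .NUW) := by
  rintro I ⟨hw, e, he, hg⟩
  exact ⟨hw, e, he, WinnerModel.Wins.mem (m := .UW) hg⟩

theorem dc_NUW_subset_UW (E : ElectionSystem) (a : ControlAction) :
    controlProblem E (dc a .NUW) ⊆ controlProblem E (dc a .UW) := by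
  rintro I ⟨hw, e, he, hg⟩
  exact ⟨hw, e, he, fun h => hg (WinnerModel.Wins.mem (m := .UW) h)⟩

/-- Eliminating the focus candidate before the final election reaches every destructive goal. -/
theorem goalMet_dc_of_notMem {E : ElectionSystem} {a : ControlAction} {m : WinnerModel}
    {D : Finset ℕ} {V : Multiset E.Ballot} {p : ℕ} (h : p ∉ D) :
    (dc a m).GoalMet (E.elect D V) p :=
  fun hw => h (E.elect_subset _ _ hw.mem)

/-- A destructive goal reached in an election shows that the focus candidate is not its only
winner. -/
theorem ne_singleton_of_goalMet_dc {a : ControlAction} {m : WinnerModel}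
    {W : Finset ℕ} {p : ℕ} (h : (dc a m).GoalMet W p) : W ≠ {p} := by
  rintro rfl
  exact h (m.wins_singleton p)

/-- `a` is one of the two actions that partition the candidates, with the tie rule `t`. -/
def IsCandidatePartition (t : TieRule) (a : ControlAction) : Prop := a = .PC t ∨ a = .RPC t

/-- A candidate eliminated by a partition of the candidates is eliminated in some subelection, and
its opponents there reach the final election only by surviving that subelection. -/
theorem exists_eliminated {E : ElectionSystem} {p w : ℕ} {t : TieRule} {a : ControlAction}
    (ha : IsCandidatePartition t a) {C : Finset ℕ} {V : Multiset E.Ballot}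
    {e : Finset ℕ × Multiset E.Ballot} (hw : w ∈ C)
    (he : e ∈ finalElections E p a (.partition C V)) (hwe : w ∉ e.1) :
    ∃ D ⊆ C, w ∈ D ∧ w ∉ t.survivors (E.elect D V) ∧
      ∀ q ∈ D, q ∈ e.1 → q ∈ t.survivors (E.elect D V) := by
  have hs (D : Finset ℕ) : t.survivors (E.elect D V) ⊆ D :=
    (t.survivors_subset _).trans (E.elect_subset _ _)
  rcases ha with rfl | rfl
  · obtain ⟨C₁, C₂, rfl, hd, rfl⟩ := he
    simp only [Finset.mem_union, not_or] at hwe hw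
    refine ⟨C₁, Finset.subset_union_left, hw.resolve_right hwe.2, hwe.1, fun q hq hqe => ?_⟩
    exact (Finset.mem_union.1 hqe).resolve_right (Finset.disjoint_left.1 hd hq)
  · obtain ⟨C₁, C₂, rfl, hd, rfl⟩ := he
    simp only [Finset.mem_union, not_or] at hwe hw
    rcases hw with hw | hw
    · refine ⟨C₁, Finset.subset_union_left, hw, hwe.1, fun q hq hqe => ?_⟩
      exact (Finset.mem_union.1 hqe).resolve_right
        fun h => Finset.disjoint_left.1 hd hq (hs _ h)
    · refine ⟨C₂, Finset.subset_union_right, hw, hwe.2, fun q hq hqe => ?_⟩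
      exact (Finset.mem_union.1 hqe).resolve_left
        fun h => Finset.disjoint_left.1 hd (hs _ h) hq

/-- Conversely, a subelection that eliminates `p` can be used as one side of the partition. -/
theorem exists_finalElection_notMem {E : ElectionSystem} {p : ℕ} {t : TieRule} {a : ControlAction}
    (ha : IsCandidatePartition t a) {C D : Finset ℕ} {V : Multiset E.Ballot}
    (hD : D ⊆ C) (hp : p ∈ D) (hpD : p ∉ t.survivors (E.elect D V)) :
    ∃ e ∈ finalElections E p a (.partition C V), p ∉ e.1 := by
  rcases ha with rfl | rfl
  · refine ⟨_, ⟨D, C \ D, Finset.union_sdiff_of_subset hD, Finset.disjoint_sdiff, rfl⟩, ?_⟩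
    simp [hpD, hp]
  · refine ⟨_, ⟨D, C \ D, Finset.union_sdiff_of_subset hD, Finset.disjoint_sdiff, rfl⟩, ?_⟩
    have h : p ∉ t.survivors (E.elect (C \ D) V) := fun h =>
      (Finset.mem_sdiff.1 (E.elect_subset _ _ (t.survivors_subset _ h))).2 hp
    simp [hpD, h]

theorem TieRule.ne_singleton_of_notMem_survivors {t : TieRule} {W : Finset ℕ} {p : ℕ}
    (h : p ∉ t.survivors W) : W ≠ {p} := by
  rintro rfl
  exact h (t.mem_survivors_singleton p)

/-- Any destructive partition of candidates needs a subelection without `p` as its only winner. -/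
theorem exists_ne_singleton_of_solvable {E : ElectionSystem} {t : TieRule} {a : ControlAction}
    {m : WinnerModel} (ha : IsCandidatePartition t a) {C : Finset ℕ} {V : Multiset E.Ballot}
    {p : ℕ} (hp : p ∈ C) (h : PartitionSolvable E (dc a m) C V p) :
    ∃ D ⊆ C, p ∈ D ∧ E.elect D V ≠ {p} := by
  obtain ⟨e, he, hg⟩ := h
  by_cases hpe : p ∈ e.1
  · obtain ⟨hs, hV⟩ := finalElections_partition_le he
    refine ⟨e.1, hs, hpe, ?_⟩
    rw [← hV]
    exact ne_singleton_of_goalMet_dc hg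
  · obtain ⟨D, hD, hpD, hn, -⟩ := exists_eliminated ha hp he hpe
    exact ⟨D, hD, hpD, TieRule.ne_singleton_of_notMem_survivors hn⟩

theorem solvable_dc_TE_iff {E : ElectionSystem} {a : ControlAction} {m : WinnerModel}
    (ha : IsCandidatePartition .TE a) {C : Finset ℕ} {V : Multiset E.Ballot}
    {p : ℕ} (hp : p ∈ C) :
    PartitionSolvable E (dc a m) C V p ↔ ∃ D ⊆ C, p ∈ D ∧ E.elect D V ≠ {p} := by
  refine ⟨exists_ne_singleton_of_solvable ha hp, ?_⟩
  rintro ⟨D, hD, hpD, hne⟩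
  obtain ⟨e, he, hpe⟩ := exists_finalElection_notMem ha hD hpD
    (V := V) (fun h => hne (TieRule.mem_survivors_TE.1 h))
  exact ⟨e, he, goalMet_dc_of_notMem hpe⟩

theorem solvable_dc_TP_NUW_iff {E : ElectionSystem} {a : ControlAction}
    (ha : IsCandidatePartition .TP a) {C : Finset ℕ} {V : Multiset E.Ballot}
    {p : ℕ} (hp : p ∈ C) :
    PartitionSolvable E (dc a .NUW) C V p ↔ ∃ D ⊆ C, p ∈ D ∧ p ∉ E.elect D V := by
  constructor
  · rintro ⟨e, he, hg⟩
    by_cases hpe : p ∈ e.1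
    · obtain ⟨hs, hV⟩ := finalElections_partition_le he
      refine ⟨e.1, hs, hpe, ?_⟩
      rw [← hV]
      exact hg
    · obtain ⟨D, hD, hpD, hn, -⟩ := exists_eliminated ha hp he hpe
      exact ⟨D, hD, hpD, hn⟩
  · rintro ⟨D, hD, hpD, hn⟩
    obtain ⟨e, he, hpe⟩ := exists_finalElection_notMem ha hD hpD (V := V) hn
    exact ⟨e, he, goalMet_dc_of_notMem hpe⟩

theorem inputKind_of_isCandidatePartition {t : TieRule} {a : ControlAction}
    (ha : IsCandidatePartition t a) : a.inputKind = .partition := by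
  rcases ha with rfl | rfl <;> rfl

theorem mem_destructiveTE {T : ControlType} (h : T ∈ destructiveTE) :
    ∃ a m, T = dc a m ∧ IsCandidatePartition .TE a := by
  simp only [destructiveTE, List.mem_cons, List.not_mem_nil, or_false] at h
  rcases h with rfl | rfl | rfl | rfl
  exacts [⟨_, _, rfl, .inr rfl⟩, ⟨_, _, rfl, .inr rfl⟩, ⟨_, _, rfl, .inl rfl⟩,
    ⟨_, _, rfl, .inl rfl⟩]

theorem mem_destructiveTPNUW {T : ControlType} (h : T ∈ destructiveTPNUW) :
    ∃ a, T = dc a .NUW ∧ IsCandidatePartition .TP a := by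
  simp only [destructiveTPNUW, List.mem_cons, List.not_mem_nil, or_false] at h
  rcases h with rfl | rfl
  exacts [⟨_, rfl, .inr rfl⟩, ⟨_, rfl, .inl rfl⟩]

theorem mem_destructiveTPUW {T : ControlType} (h : T ∈ destructiveTPUW) :
    ∃ a, T = dc a .UW ∧ IsCandidatePartition .TP a := by
  simp only [destructiveTPUW, List.mem_cons, List.not_mem_nil, or_false] at h
  rcases h with rfl | rfl
  exacts [⟨_, rfl, .inr rfl⟩, ⟨_, rfl, .inl rfl⟩]

theorem subset_of_mem_destructiveTE {E : ElectionSystem} {t : TieRule} {a : ControlAction}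
    {m : WinnerModel} (ha : IsCandidatePartition t a) {T' : ControlType}
    (hT' : T' ∈ destructiveTE) : controlProblem E (dc a m) ⊆ controlProblem E T' := by
  obtain ⟨a', m', rfl, ha'⟩ := mem_destructiveTE hT'
  exact controlProblem_subset_of_partition (inputKind_of_isCandidatePartition ha)
    fun C V p hp h => (solvable_dc_TE_iff ha' hp).2 (exists_ne_singleton_of_solvable ha hp h)

theorem destructiveTE_subset (E : ElectionSystem) :
    ∀ T ∈ destructiveTE, ∀ T' ∈ destructiveTE, controlProblem E T ⊆ controlProblem E T' := by
  intro T hT T' hT'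
  obtain ⟨a, m, rfl, ha⟩ := mem_destructiveTE hT
  exact subset_of_mem_destructiveTE ha hT'

theorem destructiveTPNUW_subset (E : ElectionSystem) :
    ∀ T ∈ destructiveTPNUW, ∀ T' ∈ destructiveTPNUW,
      controlProblem E T ⊆ controlProblem E T' := by
  intro T hT T' hT'
  obtain ⟨a, rfl, ha⟩ := mem_destructiveTPNUW hT
  obtain ⟨a', rfl, ha'⟩ := mem_destructiveTPNUW hT'
  exact controlProblem_subset_of_partition (inputKind_of_isCandidatePartition ha)
    fun C V p hp h => (solvable_dc_TP_NUW_iff ha' hp).2 ((solvable_dc_TP_NUW_iff ha hp).1 h)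

theorem destructiveTPNUW_subset_destructiveTPUW (E : ElectionSystem) :
    ∀ T ∈ destructiveTPNUW, ∀ T' ∈ destructiveTPUW,
      controlProblem E T ⊆ controlProblem E T' := by
  intro T hT T' hT'
  obtain ⟨a', rfl, ha'⟩ := mem_destructiveTPUW hT'
  have h' : dc a' .NUW ∈ destructiveTPNUW := by
    rcases ha' with rfl | rfl <;> simp [destructiveTPNUW]
  exact (destructiveTPNUW_subset E T hT _ h').trans (dc_NUW_subset_UW E a')

theorem destructiveTPUW_subset_destructiveTE (E : ElectionSystem) :
    ∀ T ∈ destructiveTPUW, ∀ T' ∈ destructiveTE, controlProblem E T ⊆ controlProblem E T' := by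
  intro T hT T' hT'
  obtain ⟨a, rfl, ha⟩ := mem_destructiveTPUW hT
  exact subset_of_mem_destructiveTE ha hT'

theorem destructiveTPNUW_subset_destructiveTE (E : ElectionSystem) :
    ∀ T ∈ destructiveTPNUW, ∀ T' ∈ destructiveTE, controlProblem E T ⊆ controlProblem E T' := by
  intro T hT T' hT'
  obtain ⟨a, rfl, ha⟩ := mem_destructiveTPNUW hT
  exact subset_of_mem_destructiveTE ha hT'

theorem generalClasses_subset (E : ElectionSystem) :
    ∀ c ∈ generalClasses, ∀ T ∈ c, ∀ T' ∈ c, controlProblem E T ⊆ controlProblem E T' := by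
  intro c hc
  simp only [generalClasses, List.mem_cons, List.not_mem_nil, or_false] at hc
  rcases hc with rfl | rfl
  · exact destructiveTE_subset E
  · exact destructiveTPNUW_subset E

theorem generalBelow_subset (E : ElectionSystem) :
    ∀ b ∈ generalBelow, ∀ T ∈ b.1, ∀ T' ∈ b.2, controlProblem E T ⊆ controlProblem E T' := by
  intro b hb T hT T' hT'
  simp only [generalBelow, List.mem_cons, List.not_mem_nil, or_false] at hb
  rcases hb with rfl | rfl
  · rcases List.mem_append.1 hT' with h | h
    · exact destructiveTPNUW_subset_destructiveTPUW E T hT T' h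
    · exact destructiveTPNUW_subset_destructiveTE E T hT T' h
  · exact destructiveTPUW_subset_destructiveTE E T hT T' hT'

/-! ### Destructive partition of voters with ties eliminating -/

/-- The votes can be partitioned so that the focus candidate is not the only winner of either
subelection. -/
def HasLosingSplit (E : ElectionSystem) (C : Finset ℕ) (V : Multiset E.Ballot) (p : ℕ) : Prop :=
  ∃ V₁ V₂ : Multiset E.Ballot, V₁ + V₂ = V ∧ E.elect C V₁ ≠ {p} ∧ E.elect C V₂ ≠ {p}

theorem solvable_of_hasLosingSplit {E : ElectionSystem} {m : WinnerModel} {C : Finset ℕ}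
    {V : Multiset E.Ballot} {p : ℕ} (h : HasLosingSplit E C V p) :
    PartitionSolvable E (dc (.PV .TE) m) C V p := by
  obtain ⟨V₁, V₂, hV, h₁, h₂⟩ := h
  refine ⟨_, ⟨V₁, V₂, hV, rfl⟩, goalMet_dc_of_notMem ?_⟩
  simp [TieRule.mem_survivors_TE, h₁, h₂]

/-- If failing to be the only winner of some `(D, V)` always yields a losing split, then every
destructive partition control yields one: it has to beat `p` in a subelection with all the votes, or
in both halves of a partition of the votes. -/
theorem hasLosingSplit_of_solvable {E : ElectionSystem} {a : ControlAction} {m : WinnerModel}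
    {C : Finset ℕ} {V : Multiset E.Ballot} {p : ℕ} (ha : a.inputKind = .partition) (hp : p ∈ C)
    (hE : ∀ D ⊆ C, p ∈ D → E.elect D V ≠ {p} → HasLosingSplit E C V p)
    (h : PartitionSolvable E (dc a m) C V p) : HasLosingSplit E C V p := by
  have hPart (t : TieRule) (ha : IsCandidatePartition t a) : HasLosingSplit E C V p := by
    obtain ⟨D, hD, hpD, hne⟩ := exists_ne_singleton_of_solvable ha hp h
    exact hE D hD hpD hne
  cases a with
  | PC t => exact hPart t (.inl rfl)
  | RPC t => exact hPart t (.inr rfl)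
  | PV t =>
    obtain ⟨e, he, hg⟩ := h
    by_cases hpe : p ∈ e.1
    · obtain ⟨hs, hV⟩ := finalElections_partition_le he
      refine hE e.1 hs hpe ?_
      rw [← hV]
      exact ne_singleton_of_goalMet_dc hg
    · obtain ⟨V₁, V₂, hV, rfl⟩ := he
      simp only [Finset.mem_union, not_or] at hpe
      exact ⟨V₁, V₂, hV, TieRule.ne_singleton_of_notMem_survivors hpe.1,
        TieRule.ne_singleton_of_notMem_survivors hpe.2⟩
  | AC => exact absurd ha (by decide)
  | UAC => exact absurd ha (by decide)
  | DC => exact absurd ha (by decide)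
  | AV => exact absurd ha (by decide)
  | DV => exact absurd ha (by decide)

theorem subset_destructivePVTE {E : ElectionSystem}
    (hE : ∀ C V p, ∀ D ⊆ C, p ∈ D → E.elect D V ≠ {p} → HasLosingSplit E C V p)
    {a : ControlAction} {m : WinnerModel} (ha : a.inputKind = .partition) {T' : ControlType}
    (hT' : T' ∈ destructivePVTE) : controlProblem E (dc a m) ⊆ controlProblem E T' := by
  simp only [destructivePVTE, List.mem_cons, List.not_mem_nil, or_false] at hT'
  refine controlProblem_subset_of_partition ha fun C V p hp h => ?_
  have hl := hasLosingSplit_of_solvable ha hp (hE C V p) h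
  rcases hT' with rfl | rfl <;> exact solvable_of_hasLosingSplit hl

/-! ### Winners of maximal score -/

theorem mem_argmaxScore {C : Finset ℕ} {s : ℕ → ℕ} {c : ℕ} :
    c ∈ argmaxScore C s ↔ c ∈ C ∧ ∀ d ∈ C, s d ≤ s c :=
  Finset.mem_filter

theorem argmaxScore_nonempty {C : Finset ℕ} (s : ℕ → ℕ) (h : C.Nonempty) :
    (argmaxScore C s).Nonempty := by
  obtain ⟨c, hc, hm⟩ := C.exists_max_image s h
  exact ⟨c, mem_argmaxScore.2 ⟨hc, hm⟩⟩

theorem argmaxScore_eq_singleton {C : Finset ℕ} {s : ℕ → ℕ} {p : ℕ} :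
    argmaxScore C s = {p} ↔ p ∈ C ∧ ∀ d ∈ C, d ≠ p → s d < s p := by
  constructor
  · intro h
    have hp : p ∈ argmaxScore C s := h ▸ Finset.mem_singleton_self p
    rw [mem_argmaxScore] at hp
    refine ⟨hp.1, fun d hd hne => lt_of_le_of_ne (hp.2 d hd) fun he => hne ?_⟩
    rw [← Finset.mem_singleton, ← h, mem_argmaxScore, he]
    exact ⟨hd, hp.2⟩
  · rintro ⟨hp, h⟩
    ext c
    rw [mem_argmaxScore, Finset.mem_singleton]
    constructor
    · rintro ⟨hc, hm⟩
      by_contra hne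
      exact absurd (hm p hp) (not_le.2 (h c hc hne))
    · rintro rfl
      refine ⟨hp, fun d hd => ?_⟩
      by_cases hd' : d = c
      · rw [hd']
      · exact (h d hd hd').le

theorem argmaxScore_congr {C : Finset ℕ} {s s' : ℕ → ℕ} (h : ∀ c ∈ C, s c = s' c) :
    argmaxScore C s = argmaxScore C s' := by
  ext c
  simp only [mem_argmaxScore]
  refine and_congr_right fun hc => forall₂_congr fun d hd => ?_
  rw [h c hc, h d hd]

theorem argmaxScore_zero (C : Finset ℕ) : argmaxScore C (fun _ => 0) = C := by
  ext c
  simp [mem_argmaxScore]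

/-! ### Plurality and veto -/

theorem plurality_elect (C : Finset ℕ) (V : Multiset (List ℕ)) :
    plurality.elect C V = argmaxScore C
      (fun c => V.countP (fun v => (v.filter (fun x => decide (x ∈ C))).head? = some c)) := by
  have h : plurality.elect C V = argmaxScore C (fun c =>
      (V.map (fun v => v.filter (fun x => decide (x ∈ C)))).countP
        (fun v => v.head? = some c)) := rfl
  rw [h]
  refine argmaxScore_congr fun c _ => ?_
  rw [Multiset.countP_map, Multiset.countP_eq_card_filter]

theorem veto_elect (C : Finset ℕ) (V : Multiset (List ℕ)) :
    veto.elect C V = argmaxScore C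
      (fun c => V.countP (fun v => (v.filter (fun x => decide (x ∈ C))).getLast? ≠ some c)) := by
  have h : veto.elect C V = argmaxScore C (fun c =>
      (V.map (fun v => v.filter (fun x => decide (x ∈ C)))).countP
        (fun v => v.getLast? ≠ some c)) := rfl
  rw [h]
  refine argmaxScore_congr fun c _ => ?_
  rw [Multiset.countP_map, Multiset.countP_eq_card_filter]

/-- A candidate that no vote ranks last is a winner, so that nobody else is the only winner. -/
theorem veto_elect_ne_singleton {C : Finset ℕ} {V : Multiset (List ℕ)} {p x : ℕ}
    (hx : x ∈ C) (hxp : x ≠ p)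
    (h : ∀ v ∈ V, (v.filter (fun x => decide (x ∈ C))).getLast? ≠ some x) :
    veto.elect C V ≠ {p} := by
  rw [veto_elect, Ne, argmaxScore_eq_singleton]
  rintro ⟨-, hlt⟩
  refine absurd (hlt x hx hxp) (not_lt.2 ?_)
  rw [Multiset.countP_eq_card.2 h]
  exact Multiset.countP_le_card _ _

theorem veto_hasLosingSplit (C : Finset ℕ) (V : Multiset (List ℕ)) (p : ℕ) (D : Finset ℕ)
    (hD : D ⊆ C) (hp : p ∈ D) (hne : veto.elect D V ≠ {p}) : HasLosingSplit veto C V p := by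
  by_cases hC : ∃ x ∈ C, ∃ y ∈ C, x ≠ p ∧ y ≠ p ∧ x ≠ y
  -- With two rivals `x` and `y`, separating the votes that veto `x` leaves each half with a rival
  -- that is not vetoed at all.
  · obtain ⟨x, hx, y, hy, hxp, hyp, hxy⟩ := hC
    let q : List ℕ → Prop := fun v => (v.filter (fun x => decide (x ∈ C))).getLast? = some x
    classical
    refine ⟨V.filter q, V.filter (fun v => ¬ q v), Multiset.filter_add_not q V, ?_, ?_⟩
    · refine veto_elect_ne_singleton hy hyp fun v hv => ?_
      rw [(Multiset.mem_filter.1 hv).2]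
      simpa using hxy
    · exact veto_elect_ne_singleton hx hxp fun v hv => (Multiset.mem_filter.1 hv).2
  -- Otherwise `D` is `C` or `{p}`, and the partition of `V` into `V` and nothing will do.
  · push Not at hC
    obtain ⟨d, hd, hdp⟩ : ∃ d ∈ D, d ≠ p := by
      by_contra! hall
      obtain ⟨c, hc⟩ : (veto.elect D V).Nonempty := by
        rw [veto_elect]
        exact argmaxScore_nonempty _ ⟨p, hp⟩
      refine hne (Finset.eq_singleton_iff_nonempty_unique_mem.2 ⟨⟨c, hc⟩, fun x hx => ?_⟩)
      exact hall x (veto.elect_subset _ _ hx)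
    have hDC : D = C := by
      refine Finset.Subset.antisymm hD fun c hc => ?_
      by_cases hcp : c = p
      · exact hcp ▸ hp
      · exact hC c hc d (hD hd) hcp hdp ▸ hd
    subst hDC
    exact ⟨V, 0, add_zero V, hne, veto_elect_ne_singleton hd hdp
      fun v hv => absurd hv (Multiset.notMem_zero v)⟩

theorem vetoTable_classes_subset :
    ∀ c ∈ vetoTable.classes, ∀ T ∈ c, ∀ T' ∈ c,
      controlProblem veto T ⊆ controlProblem veto T' := by
  intro c hc T hT T' hT'
  rcases List.mem_append.1 hc with h | h
  · exact generalClasses_subset veto c h T hT T' hT'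
  · obtain rfl := List.mem_singleton.1 h
    have := hT
    simp only [destructivePVTE, List.mem_cons, List.not_mem_nil, or_false] at this
    rcases this with rfl | rfl <;> exact subset_destructivePVTE veto_hasLosingSplit rfl hT'

theorem vetoTable_below_subset :
    ∀ b ∈ vetoTable.below, ∀ T ∈ b.1, ∀ T' ∈ b.2,
      controlProblem veto T ⊆ controlProblem veto T' := by
  intro b hb T hT T' hT'
  rcases List.mem_append.1 hb with h | h
  · exact generalBelow_subset veto b h T hT T' hT'
  · obtain rfl := List.mem_singleton.1 h
    simp only [List.mem_append] at hT
    rcases hT with ((hT | hT) | hT) | hT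
    · simp only [destructivePVTP, List.mem_cons, List.not_mem_nil, or_false] at hT
      rcases hT with rfl | rfl <;> exact subset_destructivePVTE veto_hasLosingSplit rfl hT'
    · obtain ⟨a, m, rfl, ha⟩ := mem_destructiveTE hT
      exact subset_destructivePVTE veto_hasLosingSplit (inputKind_of_isCandidatePartition ha) hT'
    · obtain ⟨a, rfl, ha⟩ := mem_destructiveTPUW hT
      exact subset_destructivePVTE veto_hasLosingSplit (inputKind_of_isCandidatePartition ha) hT'
    · obtain ⟨a, rfl, ha⟩ := mem_destructiveTPNUW hT
      exact subset_destructivePVTE veto_hasLosingSplit (inputKind_of_isCandidatePartition ha) hT'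

/-! ### Approval -/

/-- The number of votes that approve of a candidate. -/
def approvals (V : Multiset (Finset ℕ)) (c : ℕ) : ℕ := V.countP (fun v => c ∈ v)

theorem approval_elect (C : Finset ℕ) (V : Multiset (Finset ℕ)) :
    approval.elect C V = argmaxScore C (approvals V) := by
  have h : approval.elect C V =
      argmaxScore C (fun c => (V.map (fun v => v ∩ C)).countP (fun v => c ∈ v)) := rfl
  rw [h]
  refine argmaxScore_congr fun c hc => ?_
  rw [Multiset.countP_map, approvals, Multiset.countP_eq_card_filter]
  simp [hc]

theorem mem_approval_elect {C : Finset ℕ} {V : Multiset (Finset ℕ)} {p : ℕ} :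
    p ∈ approval.elect C V ↔ p ∈ C ∧ ∀ d ∈ C, approvals V d ≤ approvals V p := by
  rw [approval_elect, mem_argmaxScore]

theorem approval_elect_eq_singleton {C : Finset ℕ} {V : Multiset (Finset ℕ)} {p : ℕ} :
    approval.elect C V = {p} ↔ p ∈ C ∧ ∀ d ∈ C, d ≠ p → approvals V d < approvals V p := by
  rw [approval_elect, argmaxScore_eq_singleton]

theorem approval_elect_nonempty {C : Finset ℕ} (V : Multiset (Finset ℕ)) (h : C.Nonempty) :
    (approval.elect C V).Nonempty := by
  rw [approval_elect]
  exact argmaxScore_nonempty _ h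

theorem approval_elect_zero (C : Finset ℕ) : approval.elect C (0 : Multiset (Finset ℕ)) = C := by
  rw [approval_elect]
  exact argmaxScore_zero C

/-- Winning, alone or not, is inherited by every set of candidates that contains the winner. -/
theorem approval_wins_mono {m : WinnerModel} {C D : Finset ℕ} {V : Multiset (Finset ℕ)} {p : ℕ}
    (hD : D ⊆ C) (hp : p ∈ D) (h : m.Wins (approval.elect C V) p) :
    m.Wins (approval.elect D V) p := by
  cases m with
  | UW =>
    have h' := approval_elect_eq_singleton.1 h
    exact approval_elect_eq_singleton.2 ⟨hp, fun d hd => h'.2 d (hD hd)⟩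
  | NUW =>
    have h' := mem_approval_elect.1 h
    exact mem_approval_elect.2 ⟨hp, fun d hd => h'.2 d (hD hd)⟩

theorem approval_elect_ne_singleton_mono {C D : Finset ℕ} {V : Multiset (Finset ℕ)} {p : ℕ}
    (hD : D ⊆ C) (hp : p ∈ D) (h : approval.elect D V ≠ {p}) : approval.elect C V ≠ {p} :=
  fun h' => h (approval_wins_mono (m := .UW) hD hp h')

theorem approval_hasLosingSplit (C : Finset ℕ) (V : Multiset (Finset ℕ)) (p : ℕ) (D : Finset ℕ)
    (hD : D ⊆ C) (hp : p ∈ D) (hne : approval.elect D V ≠ {p}) :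
    HasLosingSplit approval C V p := by
  have hC := approval_elect_ne_singleton_mono hD hp hne
  refine ⟨V, 0, add_zero V, hC, ?_⟩
  intro h
  rw [show C = {p} from (approval_elect_zero C).symm.trans h] at hC
  exact hC (approval_elect_eq_singleton.2 ⟨Finset.mem_singleton_self p, fun d hd hdp =>
    absurd (Finset.mem_singleton.1 hd) hdp⟩)

theorem approval_solvable_dc_iff {T : ControlType} (hT : T ∈ destructiveTE ++ destructiveTPUW)
    {C : Finset ℕ} {V : Multiset (Finset ℕ)} {p : ℕ} (hp : p ∈ C) :
    PartitionSolvable approval T C V p ↔ approval.elect C V ≠ {p} := by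
  have hmono : (∃ D ⊆ C, p ∈ D ∧ approval.elect D V ≠ {p}) ↔ approval.elect C V ≠ {p} :=
    ⟨fun ⟨D, hD, hpD, h⟩ => approval_elect_ne_singleton_mono hD hpD h,
      fun h => ⟨C, subset_rfl, hp, h⟩⟩
  rcases List.mem_append.1 hT with hT | hT
  · obtain ⟨a, m, rfl, ha⟩ := mem_destructiveTE hT
    exact (solvable_dc_TE_iff ha hp).trans hmono
  · obtain ⟨a, rfl, ha⟩ := mem_destructiveTPUW hT
    refine ⟨fun h => hmono.1 (exists_ne_singleton_of_solvable ha hp h), fun h => ?_⟩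
    rcases ha with rfl | rfl
    · refine ⟨(C, V), ⟨∅, C, Finset.empty_union C, Finset.disjoint_empty_left C, ?_⟩, h⟩
      rw [approval_elect ∅ V]
      simp [argmaxScore, TieRule.survivors]
    · refine ⟨_, ⟨C, ∅, Finset.union_empty C, Finset.disjoint_empty_right C, rfl⟩, fun hW => ?_⟩
      -- A co-winner `d` of the whole election is still present in the final election.
      have hW' := approval_elect_eq_singleton.1 hW
      refine h (approval_elect_eq_singleton.2 ⟨hp, fun d hd hdp => ?_⟩)
      obtain ⟨w, hw⟩ := approval_elect_nonempty V ⟨p, hp⟩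
      have hwd := (mem_approval_elect.1 hw).2 d hd
      have hwp := (mem_approval_elect.1 hw).2 p hp
      by_cases hwp' : w = p
      · subst hwp'
        refine lt_of_le_of_ne hwd fun he => ?_
        have hd' : d ∈ approval.elect C V :=
          mem_approval_elect.2 ⟨hd, fun x hx => he ▸ (mem_approval_elect.1 hw).2 x hx⟩
        exact absurd (hW'.2 d (Finset.mem_union_left _ hd') hdp) (he ▸ lt_irrefl _)
      · exact absurd (hW'.2 w (Finset.mem_union_left _ hw) hwp') (not_lt.2 hwp)

/-- The partition of the votes into all of them and nothing promotes every candidate if ties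
promote. -/
theorem approval_mem_finalElections_PV_TP (C : Finset ℕ) (V : Multiset (Finset ℕ)) (p : ℕ) :
    (C, V) ∈ finalElections approval p (.PV .TP) (.partition C V) := by
  refine ⟨V, 0, add_zero V, ?_⟩
  have h : approval.elect C V ∪ C = C :=
    Finset.union_eq_right.2 (approval.elect_subset C V)
  exact congrArg (·, V) (((congrArg (approval.elect C V ∪ ·) (approval_elect_zero C)).trans h).symm)

theorem approval_destructiveTPNUW_subset_PV :
    ∀ T ∈ destructiveTPNUW, ∀ m, controlProblem approval T ⊆
      controlProblem approval (dc (.PV .TP) m) := by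
  intro T hT m
  obtain ⟨a, rfl, ha⟩ := mem_destructiveTPNUW hT
  refine controlProblem_subset_of_partition (inputKind_of_isCandidatePartition ha) ?_
  intro C V p hp h
  obtain ⟨D, hD, hpD, hn⟩ := (solvable_dc_TP_NUW_iff ha hp).1 h
  have hC : p ∉ approval.elect C V := fun h' => hn (approval_wins_mono (m := .NUW) hD hpD h')
  exact ⟨_, approval_mem_finalElections_PV_TP C V p, fun hw => hC hw.mem⟩

/-! ### Approval: constructive partition of candidates -/

/-- With ties promoting, a winner of the whole election always reaches the final election, so the
partition is of no use. -/
theorem approval_solvable_cc_TP_iff {a : ControlAction} (ha : IsCandidatePartition .TP a)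
    {m : WinnerModel} {C : Finset ℕ} {V : Multiset (Finset ℕ)} {p : ℕ} (hp : p ∈ C) :
    PartitionSolvable approval (cc a m) C V p ↔ m.Wins (approval.elect C V) p := by
  constructor
  · rintro ⟨e, he, hg⟩
    obtain ⟨hs, hV⟩ := finalElections_partition_le he
    rw [hV] at hg
    have hwin : approval.elect C V ⊆ e.1 := by
      intro w hw
      by_contra hwe
      obtain ⟨D, hD, hwD, hn, -⟩ := exists_eliminated ha (approval.elect_subset C V hw) he hwe
      exact hn (approval_wins_mono (m := .NUW) hD hwD hw)
    obtain ⟨w, hw⟩ := approval_elect_nonempty V ⟨p, hp⟩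
    have hw' := mem_approval_elect.1 hw
    cases m with
    | UW =>
      have hg' := approval_elect_eq_singleton.1 hg
      have hall : ∀ x ∈ approval.elect C V, x = p := by
        intro x hx
        by_contra hxp
        exact absurd (hg'.2 x (hwin hx) hxp) (not_lt.2 ((mem_approval_elect.1 hx).2 p hp))
      exact Finset.eq_singleton_iff_nonempty_unique_mem.2 ⟨⟨w, hw⟩, hall⟩
    | NUW =>
      have hg' := mem_approval_elect.1 hg
      exact mem_approval_elect.2 ⟨hp, fun d hd => (hw'.2 d hd).trans (hg'.2 w (hwin hw))⟩
  · intro h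
    have hsub := approval.elect_subset C V
    rcases ha with rfl | rfl
    · refine ⟨_, ⟨C, ∅, Finset.union_empty C, Finset.disjoint_empty_right C, rfl⟩, ?_⟩
      exact approval_wins_mono (Finset.union_subset hsub (Finset.empty_subset _))
        (Finset.mem_union_left _ h.mem) h
    · refine ⟨_, ⟨C, ∅, Finset.union_empty C, Finset.disjoint_empty_right C, rfl⟩, ?_⟩
      exact approval_wins_mono (Finset.union_subset hsub
        ((approval.elect_subset _ _).trans (Finset.empty_subset _)))
        (Finset.mem_union_left _ h.mem) h

/-- With ties eliminating, it is optimal to pit `p` against the survivor of all the others. -/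
theorem approval_solvable_cc_TE_iff {a : ControlAction} (ha : IsCandidatePartition .TE a)
    {m : WinnerModel} {C : Finset ℕ} {V : Multiset (Finset ℕ)} {p : ℕ} (hp : p ∈ C) :
    PartitionSolvable approval (cc a m) C V p ↔
      ∀ w, approval.elect (C.erase p) V = {w} → m.Wins (approval.elect {p, w} V) p := by
  constructor
  · rintro ⟨e, he, hg⟩ w hw
    have hV := (finalElections_partition_le he).2
    have hpe : p ∈ e.1 := approval.elect_subset _ _ (WinnerModel.Wins.mem hg)
    have hw' : w ∈ C.erase p :=
      approval.elect_subset (C.erase p) V (hw ▸ Finset.mem_singleton_self w)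
    by_cases hwe : w ∈ e.1
    · rw [hV] at hg
      exact approval_wins_mono (by simp [Finset.insert_subset_iff, hpe, hwe])
        (Finset.mem_insert_self _ _) hg
    -- The subelection that eliminates `w` must contain `p`, which is its only winner.
    · obtain ⟨D, hD, hwD, hn, hall⟩ := exists_eliminated ha (Finset.mem_of_mem_erase hw') he hwe
      have hpD : p ∈ D := by
        by_contra hpD
        refine hn (TieRule.mem_survivors_TE.2 (approval_wins_mono (m := .UW) ?_ hwD hw))
        exact fun x hx => Finset.mem_erase.2 ⟨fun h => hpD (h ▸ hx), hD hx⟩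
      have hp1 := TieRule.mem_survivors_TE.1 (hall p hpD hpe)
      exact approval_wins_mono (by simp [Finset.insert_subset_iff, hpD, hwD])
        (Finset.mem_insert_self _ _) (hp1 ▸ m.wins_singleton p)
  · intro h
    have hsingle : approval.elect {p} V = {p} :=
      approval_elect_eq_singleton.2 ⟨Finset.mem_singleton_self p, fun d hd hdp =>
        absurd (Finset.mem_singleton.1 hd) hdp⟩
    have hgoal : (cc a m).GoalMet (approval.elect
        ({p} ∪ TieRule.TE.survivors (approval.elect (C.erase p) V)) V) p := by
      by_cases hw : ∃ w, approval.elect (C.erase p) V = {w}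
      · obtain ⟨w, hw⟩ := hw
        have : ({p} ∪ TieRule.TE.survivors (approval.elect (C.erase p) V) : Finset ℕ) = {p, w} := by
          rw [hw]
          rfl
        rw [this]
        exact h w hw
      · have : ({p} ∪ TieRule.TE.survivors (approval.elect (C.erase p) V) : Finset ℕ) = {p} := by
          rw [Finset.union_eq_left]
          intro w hws
          exact (hw ⟨w, TieRule.mem_survivors_TE.1 hws⟩).elim
        rw [this, hsingle]
        exact m.wins_singleton p
    have hun : C.erase p ∪ {p} = C := by
      rw [Finset.union_comm]
      exact Finset.insert_erase hp
    have hdisj : Disjoint (C.erase p) {p} := by simp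
    rcases ha with rfl | rfl
    · refine ⟨_, ⟨C.erase p, {p}, hun, hdisj, rfl⟩, ?_⟩
      rw [Finset.union_comm] at hgoal
      exact hgoal
    · refine ⟨_, ⟨C.erase p, {p}, hun, hdisj, rfl⟩, ?_⟩
      have : TieRule.TE.survivors (approval.elect {p} V) = {p} := by
        rw [hsingle]
        rfl
      rw [Finset.union_comm, ← this] at hgoal
      exact hgoal

theorem mem_constructiveTPUW {T : ControlType} (h : T ∈ constructiveTPUW) :
    ∃ a, T = cc a .UW ∧ IsCandidatePartition .TP a := by
  simp only [constructiveTPUW, List.mem_cons, List.not_mem_nil, or_false] at h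
  rcases h with rfl | rfl
  exacts [⟨_, rfl, .inr rfl⟩, ⟨_, rfl, .inl rfl⟩]

theorem mem_constructiveTPNUW {T : ControlType} (h : T ∈ constructiveTPNUW) :
    ∃ a, T = cc a .NUW ∧ IsCandidatePartition .TP a := by
  simp only [constructiveTPNUW, List.mem_cons, List.not_mem_nil, or_false] at h
  rcases h with rfl | rfl
  exacts [⟨_, rfl, .inr rfl⟩, ⟨_, rfl, .inl rfl⟩]

theorem mem_constructiveTEUW {T : ControlType} (h : T ∈ constructiveTEUW) :
    ∃ a, T = cc a .UW ∧ IsCandidatePartition .TE a := by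
  simp only [constructiveTEUW, List.mem_cons, List.not_mem_nil, or_false] at h
  rcases h with rfl | rfl
  exacts [⟨_, rfl, .inr rfl⟩, ⟨_, rfl, .inl rfl⟩]

theorem mem_constructiveTENUW {T : ControlType} (h : T ∈ constructiveTENUW) :
    ∃ a, T = cc a .NUW ∧ IsCandidatePartition .TE a := by
  simp only [constructiveTENUW, List.mem_cons, List.not_mem_nil, or_false] at h
  rcases h with rfl | rfl
  exacts [⟨_, rfl, .inr rfl⟩, ⟨_, rfl, .inl rfl⟩]

theorem WinnerModel.Wins.weaken {m m' : WinnerModel} (hm : m = m' ∨ m' = .NUW) {W : Finset ℕ}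
    {p : ℕ} (h : m.Wins W p) : m'.Wins W p := by
  rcases hm with rfl | rfl
  exacts [h, h.mem]

theorem approval_cc_TP_subset_TP {a a' : ControlAction} (ha : IsCandidatePartition .TP a)
    (ha' : IsCandidatePartition .TP a') {m m' : WinnerModel} (hm : m = m' ∨ m' = .NUW) :
    controlProblem approval (cc a m) ⊆ controlProblem approval (cc a' m') :=
  controlProblem_subset_of_partition (inputKind_of_isCandidatePartition ha) fun _ _ _ hp h =>
    (approval_solvable_cc_TP_iff ha' hp).2 (((approval_solvable_cc_TP_iff ha hp).1 h).weaken hm)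

theorem approval_cc_TE_subset_TE {a a' : ControlAction} (ha : IsCandidatePartition .TE a)
    (ha' : IsCandidatePartition .TE a') {m m' : WinnerModel} (hm : m = m' ∨ m' = .NUW) :
    controlProblem approval (cc a m) ⊆ controlProblem approval (cc a' m') :=
  controlProblem_subset_of_partition (inputKind_of_isCandidatePartition ha) fun _ _ _ hp h =>
    (approval_solvable_cc_TE_iff ha' hp).2 fun w hw =>
      ((approval_solvable_cc_TE_iff ha hp).1 h w hw).weaken hm

theorem approval_cc_TP_subset_TE {a a' : ControlAction} (ha : IsCandidatePartition .TP a)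
    (ha' : IsCandidatePartition .TE a') {m m' : WinnerModel} (hm : m = m' ∨ m' = .NUW) :
    controlProblem approval (cc a m) ⊆ controlProblem approval (cc a' m') := by
  refine controlProblem_subset_of_partition (inputKind_of_isCandidatePartition ha) ?_
  intro C V p hp h
  refine (approval_solvable_cc_TE_iff ha' hp).2 fun w hw => ?_
  have hw' : w ∈ C.erase p := approval.elect_subset (C.erase p) V (hw ▸ Finset.mem_singleton_self w)
  refine approval_wins_mono ?_ (Finset.mem_insert_self _ _)
    (((approval_solvable_cc_TP_iff ha hp).1 h).weaken hm)
  simp [Finset.insert_subset_iff, hp, Finset.mem_of_mem_erase hw']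

theorem approval_cc_TPUW_subset_PV {a : ControlAction} (ha : IsCandidatePartition .TP a)
    (t : TieRule) (m : WinnerModel) :
    controlProblem approval (cc a .UW) ⊆ controlProblem approval (cc (.PV t) m) := by
  refine controlProblem_subset_of_partition (inputKind_of_isCandidatePartition ha) ?_
  intro C V p hp h
  have hw : approval.elect C V = {p} := (approval_solvable_cc_TP_iff ha hp).1 h
  refine ⟨_, ⟨V, 0, add_zero V, rfl⟩, ?_⟩
  have hs (U : Multiset (Finset ℕ)) : t.survivors (approval.elect C U) ⊆ C :=
    (t.survivors_subset _).trans (approval.elect_subset _ _)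
  refine approval_wins_mono (Finset.union_subset (hs V) (hs 0)) (Finset.mem_union_left _ ?_)
    (hw ▸ m.wins_singleton p)
  rw [hw]
  exact t.mem_survivors_singleton p

theorem approval_cc_TPNUW_subset_PV {a : ControlAction} (ha : IsCandidatePartition .TP a) :
    controlProblem approval (cc a .NUW) ⊆ controlProblem approval (cc (.PV .TP) .NUW) :=
  controlProblem_subset_of_partition (inputKind_of_isCandidatePartition ha) fun C V p hp h =>
    ⟨_, approval_mem_finalElections_PV_TP C V p, (approval_solvable_cc_TP_iff ha hp).1 h⟩

/-! ### Approval: deleting candidates against deleting voters -/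

/-- Deleting candidates is of no use for a destructive goal in approval voting, and deleting no vote
at all is always possible. -/
theorem approval_dc_DC_subset_DV (m : WinnerModel) :
    controlProblem approval (dc .DC m) ⊆ controlProblem approval (dc .DV m) := by
  rintro ⟨R, p⟩ ⟨hw, e, he, hg⟩
  refine ⟨hw, ?_⟩
  cases R with
  | delete C V k =>
    obtain ⟨C', -, -, hp, rfl⟩ := he
    refine ⟨(C, V), ⟨0, V, zero_add V, Nat.zero_le _, rfl⟩, fun h => hg ?_⟩
    exact approval_wins_mono Finset.sdiff_subset (Finset.mem_sdiff.2 ⟨hw.2, hp⟩) h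
  | partition C V => exact he.elim
  | addCandidates C A V k => exact he.elim
  | addCandidatesUnlimited C A V => exact he.elim
  | addVoters C V W k => exact he.elim

/-! ### Soundness of the approval table -/

theorem approvalTable_classes_subset :
    ∀ c ∈ approvalTable.classes, ∀ T ∈ c, ∀ T' ∈ c,
      controlProblem approval T ⊆ controlProblem approval T' := by
  intro c hc T hT T' hT'
  simp only [approvalTable, List.mem_cons, List.not_mem_nil, or_false] at hc
  rcases hc with rfl | rfl | rfl | rfl | rfl | rfl | rfl
  · have hk : T.action.inputKind = .partition := by
      rcases List.mem_append.1 hT with h | h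
      · obtain ⟨a, m, rfl, ha⟩ := mem_destructiveTE h
        exact inputKind_of_isCandidatePartition ha
      · obtain ⟨a, rfl, ha⟩ := mem_destructiveTPUW h
        exact inputKind_of_isCandidatePartition ha
    exact controlProblem_subset_of_partition hk fun C V p hp h =>
      (approval_solvable_dc_iff hT' hp).2 ((approval_solvable_dc_iff hT hp).1 h)
  · exact destructiveTPNUW_subset approval T hT T' hT'
  · have := hT
    simp only [destructivePVTE, List.mem_cons, List.not_mem_nil, or_false] at this
    rcases this with rfl | rfl <;> exact subset_destructivePVTE approval_hasLosingSplit rfl hT'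
  · obtain ⟨a, rfl, ha⟩ := mem_constructiveTPUW hT
    obtain ⟨a', rfl, ha'⟩ := mem_constructiveTPUW hT'
    exact approval_cc_TP_subset_TP ha ha' (.inl rfl)
  · obtain ⟨a, rfl, ha⟩ := mem_constructiveTPNUW hT
    obtain ⟨a', rfl, ha'⟩ := mem_constructiveTPNUW hT'
    exact approval_cc_TP_subset_TP ha ha' (.inl rfl)
  · obtain ⟨a, rfl, ha⟩ := mem_constructiveTEUW hT
    obtain ⟨a', rfl, ha'⟩ := mem_constructiveTEUW hT'
    exact approval_cc_TE_subset_TE ha ha' (.inl rfl)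
  · obtain ⟨a, rfl, ha⟩ := mem_constructiveTENUW hT
    obtain ⟨a', rfl, ha'⟩ := mem_constructiveTENUW hT'
    exact approval_cc_TE_subset_TE ha ha' (.inl rfl)

theorem approvalTable_below_subset :
    ∀ b ∈ approvalTable.below, ∀ T ∈ b.1, ∀ T' ∈ b.2,
      controlProblem approval T ⊆ controlProblem approval T' := by
  intro b hb T hT T' hT'
  simp only [approvalTable, List.mem_cons, List.not_mem_nil, or_false] at hb
  rcases hb with rfl | rfl | rfl | rfl | rfl | rfl | rfl | rfl
  · simp only [List.mem_append] at hT'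
    rcases hT' with ((hT' | hT') | hT') | hT'
    · exact destructiveTPNUW_subset_destructiveTE approval T hT T' hT'
    · exact destructiveTPNUW_subset_destructiveTPUW approval T hT T' hT'
    · simp only [destructivePVTP, List.mem_cons, List.not_mem_nil, or_false] at hT'
      rcases hT' with rfl | rfl <;> exact approval_destructiveTPNUW_subset_PV T hT _
    · obtain ⟨a, rfl, ha⟩ := mem_destructiveTPNUW hT
      exact subset_destructivePVTE approval_hasLosingSplit (inputKind_of_isCandidatePartition ha)
        hT'
  · have hk : ∃ a m, T = dc a m ∧ a.inputKind = .partition := by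
      rcases List.mem_append.1 hT with h | h
      · obtain ⟨a, m, rfl, ha⟩ := mem_destructiveTE h
        exact ⟨a, m, rfl, inputKind_of_isCandidatePartition ha⟩
      · obtain ⟨a, rfl, ha⟩ := mem_destructiveTPUW h
        exact ⟨a, _, rfl, inputKind_of_isCandidatePartition ha⟩
    obtain ⟨a, m, rfl, ha⟩ := hk
    rcases List.mem_append.1 hT' with h | h
    · obtain rfl := List.mem_singleton.1 h
      exact controlProblem_subset_of_partition ha fun C V p hp h =>
        ⟨_, approval_mem_finalElections_PV_TP C V p, (approval_solvable_dc_iff hT hp).1 h⟩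
    · exact subset_destructivePVTE approval_hasLosingSplit ha h
  · simp only [destructivePVTP, List.mem_cons, List.not_mem_nil, or_false] at hT
    rcases hT with rfl | rfl <;> exact subset_destructivePVTE approval_hasLosingSplit rfl hT'
  · obtain ⟨a, rfl, ha⟩ := mem_constructiveTPUW hT
    simp only [List.mem_append] at hT'
    rcases hT' with ((hT' | hT') | hT') | hT'
    · obtain ⟨a', rfl, ha'⟩ := mem_constructiveTPNUW hT'
      exact approval_cc_TP_subset_TP ha ha' (.inr rfl)
    · obtain ⟨a', rfl, ha'⟩ := mem_constructiveTEUW hT'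
      exact approval_cc_TP_subset_TE ha ha' (.inl rfl)
    · obtain ⟨a', rfl, ha'⟩ := mem_constructiveTENUW hT'
      exact approval_cc_TP_subset_TE ha ha' (.inr rfl)
    · simp only [List.mem_cons, List.not_mem_nil, or_false] at hT'
      rcases hT' with rfl | rfl | rfl | rfl <;> exact approval_cc_TPUW_subset_PV ha _ _
  · obtain ⟨a, rfl, ha⟩ := mem_constructiveTPNUW hT
    rcases List.mem_append.1 hT' with hT' | hT'
    · obtain ⟨a', rfl, ha'⟩ := mem_constructiveTENUW hT'
      exact approval_cc_TP_subset_TE ha ha' (.inr rfl)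
    · obtain rfl := List.mem_singleton.1 hT'
      exact approval_cc_TPNUW_subset_PV ha
  · obtain ⟨a, rfl, ha⟩ := mem_constructiveTEUW hT
    obtain ⟨a', rfl, ha'⟩ := mem_constructiveTENUW hT'
    exact approval_cc_TE_subset_TE ha ha' (.inr rfl)
  · obtain rfl := List.mem_singleton.1 hT
    simp only [List.mem_cons, List.not_mem_nil, or_false] at hT'
    rcases hT' with rfl | rfl
    · exact approval_dc_DC_subset_DV .NUW
    · exact (approval_dc_DC_subset_DV .NUW).trans (dc_NUW_subset_UW _ _)
  · obtain rfl := List.mem_singleton.1 hT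
    obtain rfl := List.mem_singleton.1 hT'
    exact approval_dc_DC_subset_DV .UW

/-! ### Evaluating control problems on explicit inputs -/

/-- The multiset of votes given by a list of votes with multiplicities. -/
def expand {α : Type} : List (α × ℕ) → Multiset α
  | [] => 0
  | x :: L => Multiset.replicate x.2 x.1 + expand L

/-- All ways of splitting votes, given with multiplicities, into two parts. -/
def voteSplits {α : Type} : List (α × ℕ) → List (List (α × ℕ) × List (α × ℕ))
  | [] => [([], [])]
  | x :: L => (voteSplits L).flatMap fun s =>
      (List.range (x.2 + 1)).map fun i => ((x.1, i) :: s.1, (x.1, x.2 - i) :: s.2)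

theorem exists_of_add_eq_replicate_add {β : Type} {x : β} {U : Multiset β} :
    ∀ {m : ℕ} {V₁ V₂ : Multiset β}, V₁ + V₂ = Multiset.replicate m x + U →
      ∃ i ≤ m, ∃ B₁ B₂, B₁ + B₂ = U ∧ V₁ = Multiset.replicate i x + B₁ ∧
        V₂ = Multiset.replicate (m - i) x + B₂
  | 0, V₁, V₂, h => ⟨0, le_rfl, V₁, V₂, by simpa using h, by simp, by simp⟩
  | m + 1, V₁, V₂, h => by
    rw [Multiset.replicate_succ, Multiset.cons_add] at h
    have hx : x ∈ V₁ + V₂ := h ▸ Multiset.mem_cons_self _ _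
    rcases Multiset.mem_add.1 hx with hx | hx
    · obtain ⟨V, rfl⟩ := Multiset.exists_cons_of_mem hx
      rw [Multiset.cons_add, Multiset.cons_inj_right] at h
      obtain ⟨i, hi, B₁, B₂, hB, rfl, rfl⟩ := exists_of_add_eq_replicate_add h
      refine ⟨i + 1, Nat.succ_le_succ hi, B₁, B₂, hB, ?_, by rw [Nat.add_sub_add_right]⟩
      rw [Multiset.replicate_succ, Multiset.cons_add]
    · obtain ⟨V, rfl⟩ := Multiset.exists_cons_of_mem hx
      rw [Multiset.add_cons, Multiset.cons_inj_right] at h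
      obtain ⟨i, hi, B₁, B₂, hB, rfl, rfl⟩ := exists_of_add_eq_replicate_add h
      refine ⟨i, Nat.le_succ_of_le hi, B₁, B₂, hB, rfl, ?_⟩
      rw [Nat.succ_sub hi, Multiset.replicate_succ, Multiset.cons_add]

theorem add_eq_map_expand_iff {α β : Type} (f : α → β) :
    ∀ (L : List (α × ℕ)) (V₁ V₂ : Multiset β), V₁ + V₂ = (expand L).map f ↔
      ∃ s ∈ voteSplits L, V₁ = (expand s.1).map f ∧ V₂ = (expand s.2).map f
  | [], V₁, V₂ => by simp [expand, voteSplits]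
  | x :: L, V₁, V₂ => by
    simp only [expand, voteSplits, Multiset.map_add, Multiset.map_replicate, List.mem_flatMap,
      List.mem_map, List.mem_range]
    constructor
    · intro h
      obtain ⟨i, hi, B₁, B₂, hB, rfl, rfl⟩ := exists_of_add_eq_replicate_add h
      obtain ⟨s, hs, rfl, rfl⟩ := (add_eq_map_expand_iff f L B₁ B₂).1 hB
      exact ⟨_, ⟨s, hs, i, Nat.lt_succ_of_le hi, rfl⟩, by simp [expand], by simp [expand]⟩
    · rintro ⟨_, ⟨s, hs, i, hi, rfl⟩, rfl, rfl⟩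
      have hs' := (add_eq_map_expand_iff f L _ _).2 ⟨s, hs, rfl, rfl⟩
      have hr : Multiset.replicate x.2 (f x.1) =
          Multiset.replicate i (f x.1) + Multiset.replicate (x.2 - i) (f x.1) := by
        rw [← Multiset.replicate_add, Nat.add_sub_cancel' (Nat.le_of_lt_succ hi)]
      simp only [expand, Multiset.map_add, Multiset.map_replicate]
      rw [hr, ← hs']
      ac_rfl

/-- The number of votes in a list of votes with multiplicities. -/
def voteCount {α : Type} (L : List (α × ℕ)) : ℕ := (L.map Prod.snd).sum

theorem card_expand {α : Type} : ∀ L : List (α × ℕ), (expand L).card = voteCount L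
  | [] => rfl
  | x :: L => by simp [expand, voteCount, card_expand L]

/-- All ways of splitting a list of candidates into two parts. -/
def candSplits : List ℕ → List (List ℕ × List ℕ)
  | [] => [([], [])]
  | c :: l => (candSplits l).flatMap fun s => [(c :: s.1, s.2), (s.1, c :: s.2)]

theorem filter_mem_candSplits (q : ℕ → Bool) :
    ∀ l : List ℕ, (l.filter q, l.filter (fun c => !q c)) ∈ candSplits l
  | [] => by simp [candSplits]
  | c :: l => by
    have h := filter_mem_candSplits q l
    simp only [candSplits, List.mem_flatMap]
    refine ⟨_, h, ?_⟩
    cases hq : q c <;> simp [hq]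

theorem union_of_mem_candSplits : ∀ {l : List ℕ} {s : List ℕ × List ℕ}, s ∈ candSplits l →
    s.1.toFinset ∪ s.2.toFinset = l.toFinset
  | [], s, h => by
    obtain rfl := List.mem_singleton.1 h
    rfl
  | c :: l, s, h => by
    simp only [candSplits, List.mem_flatMap, List.mem_cons, List.not_mem_nil, or_false] at h
    obtain ⟨s', hs', rfl | rfl⟩ := h <;> simp [← union_of_mem_candSplits hs']

theorem disjoint_of_mem_candSplits : ∀ {l : List ℕ} {s : List ℕ × List ℕ}, l.Nodup →
    s ∈ candSplits l → Disjoint s.1.toFinset s.2.toFinset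
  | [], s, _, h => by
    obtain rfl := List.mem_singleton.1 h
    simp
  | c :: l, s, hl, h => by
    simp only [candSplits, List.mem_flatMap, List.mem_cons, List.not_mem_nil, or_false] at h
    rw [List.nodup_cons] at hl
    obtain ⟨s', hs', h⟩ := h
    have hd := disjoint_of_mem_candSplits hl.2 hs'
    have hc : c ∉ s'.1.toFinset ∪ s'.2.toFinset := by
      rw [union_of_mem_candSplits hs', List.mem_toFinset]
      exact hl.1
    simp only [Finset.mem_union, not_or] at hc
    rcases h with rfl | rfl
    · rw [List.toFinset_cons, Finset.disjoint_insert_left]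
      exact ⟨hc.2, hd⟩
    · rw [List.toFinset_cons, Finset.disjoint_insert_right]
      exact ⟨hc.1, hd⟩

theorem partition_iff_candSplits {l : List ℕ} (hl : l.Nodup) {C₁ C₂ : Finset ℕ} :
    (C₁ ∪ C₂ = l.toFinset ∧ Disjoint C₁ C₂) ↔
      ∃ s ∈ candSplits l, C₁ = s.1.toFinset ∧ C₂ = s.2.toFinset := by
  constructor
  · rintro ⟨hu, hd⟩
    refine ⟨_, filter_mem_candSplits (fun c => decide (c ∈ C₁)) l, ?_, ?_⟩
    · ext c
      have := Finset.ext_iff.1 hu c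
      simp only [Finset.mem_union, List.mem_toFinset] at this
      simp only [List.mem_toFinset, List.mem_filter, decide_eq_true_eq]
      tauto
    · ext c
      have := Finset.ext_iff.1 hu c
      have hc : c ∈ C₁ → c ∉ C₂ := fun h => Finset.disjoint_left.1 hd h
      simp only [Finset.mem_union, List.mem_toFinset] at this
      simp only [List.mem_toFinset, List.mem_filter, Bool.not_eq_true', decide_eq_false_iff_not]
      tauto
  · rintro ⟨s, hs, rfl, rfl⟩
    exact ⟨union_of_mem_candSplits hs, disjoint_of_mem_candSplits hl hs⟩

/-- Membership of a number in a list, by the primitive comparison of numbers. -/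
def hasElem (l : List ℕ) (c : ℕ) : Bool := l.any (Nat.beq c)

theorem hasElem_iff {l : List ℕ} {c : ℕ} : hasElem l c = true ↔ c ∈ l := by
  simp [hasElem, List.any_eq_true]

theorem hasElem_eq_decide (l : List ℕ) (c : ℕ) : hasElem l c = decide (c ∈ l) := by
  rw [Bool.eq_iff_iff, hasElem_iff, decide_eq_true_eq]

/-- Computable data for an election system in which the candidates with most points win. Votes are
encoded as lists of candidates: `valid C v` says that `v` encodes a vote over `C`, and `point D v c`
that `c` gets a point from the vote `v` masked down to `D`. -/
structure PointRule (E : ElectionSystem) where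
  decode : List ℕ → E.Ballot
  valid : List ℕ → List ℕ → Bool
  point : List ℕ → List ℕ → ℕ → Bool
  isBallot : ∀ {C v : List ℕ}, valid C v = true → E.IsBallot C.toFinset (decode v)
  elect_eq : ∀ (D : List ℕ) (V : Multiset (List ℕ)), E.elect D.toFinset (V.map decode) =
    argmaxScore D.toFinset (fun c => V.countP (fun v => point D v c = true))

/-- A list encodes a linear ordering of the candidates in `C`. -/
def validLinear (C v : List ℕ) : Bool :=
  decide v.Nodup && (v.all (hasElem C) && C.all (hasElem v))

theorem isLinearBallot_of_validLinear {C v : List ℕ} (h : validLinear C v = true) :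
    IsLinearBallot C.toFinset v := by
  simp only [validLinear, Bool.and_eq_true, decide_eq_true_eq, List.all_eq_true, hasElem_iff] at h
  refine ⟨h.1, ?_⟩
  ext c
  rw [List.mem_toFinset, List.mem_toFinset]
  exact ⟨fun hc => h.2.1 c hc, fun hc => h.2.2 c hc⟩

/-- The comparison of an optional number with a number. -/
def isSomeEq (o : Option ℕ) (c : ℕ) : Bool :=
  match o with
  | none => false
  | some d => Nat.beq d c

theorem isSomeEq_iff {o : Option ℕ} {c : ℕ} : isSomeEq o c = true ↔ o = some c := by
  cases o <;> simp [isSomeEq]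

theorem filter_hasElem (D v : List ℕ) :
    v.filter (hasElem D) = v.filter (fun x => decide (x ∈ D.toFinset)) := by
  refine List.filter_congr fun x _ => ?_
  rw [hasElem_eq_decide]
  simp

/-- Plurality, with votes encoded by themselves. -/
def pluralityRule : PointRule plurality where
  decode v := v
  valid := validLinear
  point D v c := isSomeEq (v.filter (hasElem D)).head? c
  isBallot h := isLinearBallot_of_validLinear h
  elect_eq D V := by
    have h : plurality.elect D.toFinset (V.map fun v => v) =
        plurality.elect D.toFinset V := congrArg (plurality.elect D.toFinset) (Multiset.map_id' V)
    refine h.trans ((plurality_elect _ _).trans (argmaxScore_congr fun c _ => ?_))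
    simp only [isSomeEq_iff, filter_hasElem]

/-- Veto, with votes encoded by themselves. -/
def vetoRule : PointRule veto where
  decode v := v
  valid := validLinear
  point D v c := !isSomeEq (v.filter (hasElem D)).getLast? c
  isBallot h := isLinearBallot_of_validLinear h
  elect_eq D V := by
    have h : veto.elect D.toFinset (V.map fun v => v) =
        veto.elect D.toFinset V := congrArg (veto.elect D.toFinset) (Multiset.map_id' V)
    refine h.trans ((veto_elect _ _).trans (argmaxScore_congr fun c _ => ?_))
    simp only [Bool.not_eq_true', ← Bool.not_eq_true, isSomeEq_iff, filter_hasElem, ne_eq]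

/-- Approval voting, with a vote encoded by a list of the approved candidates. Masking the vote does
not change who of the remaining candidates gets a point. -/
def approvalRule : PointRule approval where
  decode v := v.toFinset
  valid C v := v.all (hasElem C)
  point _ v c := hasElem v c
  isBallot h := by
    simp only [List.all_eq_true, hasElem_iff] at h
    intro c hc
    rw [List.mem_toFinset] at hc ⊢
    exact h c hc
  elect_eq D V := by
    refine (approval_elect _ _).trans (argmaxScore_congr fun c _ => ?_)
    change (V.map fun v => v.toFinset).countP (fun v => c ∈ v) = _
    rw [Multiset.countP_map, Multiset.countP_eq_card_filter]
    simp only [hasElem_iff, List.mem_toFinset]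

namespace PointRule

variable {E : ElectionSystem} (r : PointRule E)

/-- The votes encoded by a list of encoded votes with multiplicities. -/
def votes (L : List (List ℕ × ℕ)) : Multiset E.Ballot := (expand L).map r.decode

/-- The score of the candidate `c` in the election with candidates `D` and votes `L`. -/
def score (D : List ℕ) (c : ℕ) : List (List ℕ × ℕ) → ℕ
  | [] => 0
  | x :: L => bif r.point D x.1 c then x.2 + score D c L else score D c L

theorem countP_expand (D : List ℕ) (c : ℕ) :
    ∀ L, (expand L).countP (fun v => r.point D v c = true) = r.score D c L
  | [] => rfl
  | x :: L => by
    rw [expand, Multiset.countP_add, countP_expand D c L, score]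
    cases h : r.point D x.1 c
    · rw [Multiset.countP_eq_zero.2]
      · simp
      · intro v hv
        rw [Multiset.eq_of_mem_replicate hv, h]
        simp
    · rw [Multiset.countP_eq_card.2]
      · simp
      · intro v hv
        rw [Multiset.eq_of_mem_replicate hv, h]

end PointRule

/-- The first components of the pairs with maximal second component. -/
def topScorers (s : List (ℕ × ℕ)) : List ℕ :=
  (s.filter (fun x => s.all (fun y => Nat.ble y.2 x.2))).map Prod.fst

namespace PointRule

variable {E : ElectionSystem} (r : PointRule E)

/-- The winners of the election with candidates `D` and votes `L`. -/
def winnerList (D : List ℕ) (L : List (List ℕ × ℕ)) : List ℕ :=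
  topScorers (D.map (fun c => (c, r.score D c L)))

theorem toFinset_winnerList (D : List ℕ) (L : List (List ℕ × ℕ)) :
    (r.winnerList D L).toFinset = E.elect D.toFinset (r.votes L) := by
  rw [votes, r.elect_eq]
  ext c
  rw [mem_argmaxScore]
  simp only [winnerList, topScorers, List.mem_toFinset, List.mem_map, List.mem_filter,
    List.all_eq_true, Nat.ble_eq, countP_expand]
  constructor
  · rintro ⟨_, ⟨⟨c, hc, rfl⟩, h⟩, rfl⟩
    exact ⟨hc, fun d hd => h _ ⟨d, hd, rfl⟩⟩
  · rintro ⟨hc, h⟩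
    refine ⟨_, ⟨⟨c, hc, rfl⟩, ?_⟩, rfl⟩
    rintro _ ⟨d, hd, rfl⟩
    exact h d hd

end PointRule

/-- All members of the list are equal to `p`, and there is one. -/
def isOnly (p : ℕ) (W : List ℕ) : Bool := hasElem W p && W.all (Nat.beq p)

theorem isOnly_iff {p : ℕ} {W : List ℕ} : isOnly p W = true ↔ W.toFinset = {p} := by
  rw [isOnly, Bool.and_eq_true, hasElem_iff, Finset.eq_singleton_iff_unique_mem]
  simp only [List.all_eq_true, List.mem_toFinset, Nat.beq_eq]
  exact and_congr_right fun _ => forall₂_congr fun x _ => eq_comm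

/-- The list form of `TieRule.survivors`. -/
def survivorList : TieRule → List ℕ → List ℕ
  | .TP, W => W
  | .TE, [] => []
  | .TE, p :: W => bif W.all (Nat.beq p) then [p] else []

theorem toFinset_survivorList (t : TieRule) (W : List ℕ) :
    (survivorList t W).toFinset = t.survivors W.toFinset := by
  cases t with
  | TP => rfl
  | TE =>
    ext x
    rw [TieRule.mem_survivors_TE]
    cases W with
    | nil => simp [survivorList]
    | cons p W =>
      have hx : (p :: W).toFinset = {x} ↔ x = p ∧ W.all (Nat.beq p) = true := by
        rw [Finset.eq_singleton_iff_unique_mem]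
        simp only [List.mem_toFinset, List.mem_cons, forall_eq_or_imp, List.all_eq_true,
          Nat.beq_eq]
        constructor
        · rintro ⟨-, rfl, h⟩
          exact ⟨rfl, fun y hy => (h y hy).symm⟩
        · rintro ⟨rfl, h⟩
          exact ⟨.inl rfl, rfl, fun y hy => (h y hy).symm⟩
      rw [hx, survivorList]
      cases W.all (Nat.beq p) <;> simp

/-- The list form of `ReducedInput`. -/
inductive ListInput
  | partition (C : List ℕ) (V : List (List ℕ × ℕ))
  | addCandidates (C A : List ℕ) (V : List (List ℕ × ℕ)) (k : ℕ)
  | addCandidatesUnlimited (C A : List ℕ) (V : List (List ℕ × ℕ))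
  | delete (C : List ℕ) (V : List (List ℕ × ℕ)) (k : ℕ)
  | addVoters (C : List ℕ) (V W : List (List ℕ × ℕ)) (k : ℕ)

namespace PointRule

variable {E : ElectionSystem} (r : PointRule E)

/-- The reduced input encoded by lists. -/
def input : ListInput → ReducedInput E.Ballot
  | .partition C V => .partition C.toFinset (r.votes V)
  | .addCandidates C A V k => .addCandidates C.toFinset A.toFinset (r.votes V) k
  | .addCandidatesUnlimited C A V => .addCandidatesUnlimited C.toFinset A.toFinset (r.votes V)
  | .delete C V k => .delete C.toFinset (r.votes V) k
  | .addVoters C V W k => .addVoters C.toFinset (r.votes V) (r.votes W) k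

/-- All encoded votes are votes over `C`. -/
def validVotes (C : List ℕ) (V : List (List ℕ × ℕ)) : Bool := V.all (fun x => r.valid C x.1)

theorem isBallot_of_validVotes {C : List ℕ} : ∀ {V : List (List ℕ × ℕ)},
    r.validVotes C V = true → ∀ v ∈ r.votes V, E.IsBallot C.toFinset v
  | [], _, v, hv => absurd hv (Multiset.notMem_zero v)
  | x :: V, h, v, hv => by
    rw [validVotes, List.all_cons, Bool.and_eq_true] at h
    rw [votes, expand, Multiset.map_add, Multiset.mem_add, Multiset.map_replicate] at hv
    rcases hv with hv | hv
    · rw [Multiset.eq_of_mem_replicate hv]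
      exact r.isBallot h.1
    · exact isBallot_of_validVotes h.2 v hv

/-- A list input is duplicate-free and well formed, and `p` is one of its candidates. -/
def validInput (p : ℕ) : ListInput → Bool
  | .partition C V => decide C.Nodup && (hasElem C p && r.validVotes C V)
  | .addCandidates C A V _ => decide (C ++ A).Nodup && (hasElem C p && r.validVotes (C ++ A) V)
  | .addCandidatesUnlimited C A V =>
      decide (C ++ A).Nodup && (hasElem C p && r.validVotes (C ++ A) V)
  | .delete C V _ => decide C.Nodup && (hasElem C p && r.validVotes C V)
  | .addVoters C V W _ =>
      decide C.Nodup && (hasElem C p && (r.validVotes C V && r.validVotes C W))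

theorem wellFormed_of_validInput {p : ℕ} {I : ListInput} (h : r.validInput p I = true) :
    ((r.input I).inflate p).WellFormed E := by
  have hA {C A : List ℕ} (hCA : (C ++ A).Nodup) {V : List (List ℕ × ℕ)}
      (hV : r.validVotes (C ++ A) V = true) : Disjoint C.toFinset A.toFinset ∧
      ∀ v ∈ r.votes V, E.IsBallot (C.toFinset ∪ A.toFinset) v := by
    rw [← List.toFinset_append]
    refine ⟨Finset.disjoint_left.2 fun c hc hcA => ?_, r.isBallot_of_validVotes hV⟩
    rw [List.mem_toFinset] at hc hcA
    exact (List.nodup_append.1 hCA).2.2 c hc c hcA rfl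
  cases I with
  | partition C V =>
    simp only [validInput, Bool.and_eq_true, decide_eq_true_eq, hasElem_iff] at h
    exact ⟨r.isBallot_of_validVotes h.2.2, List.mem_toFinset.2 h.2.1⟩
  | addCandidates C A V k =>
    simp only [validInput, Bool.and_eq_true, decide_eq_true_eq, hasElem_iff] at h
    exact ⟨hA h.1 h.2.2, List.mem_toFinset.2 h.2.1⟩
  | addCandidatesUnlimited C A V =>
    simp only [validInput, Bool.and_eq_true, decide_eq_true_eq, hasElem_iff] at h
    exact ⟨hA h.1 h.2.2, List.mem_toFinset.2 h.2.1⟩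
  | delete C V k =>
    simp only [validInput, Bool.and_eq_true, decide_eq_true_eq, hasElem_iff] at h
    exact ⟨r.isBallot_of_validVotes h.2.2, List.mem_toFinset.2 h.2.1⟩
  | addVoters C V W k =>
    simp only [validInput, Bool.and_eq_true, decide_eq_true_eq, hasElem_iff] at h
    exact ⟨⟨r.isBallot_of_validVotes h.2.2.1, r.isBallot_of_validVotes h.2.2.2⟩,
      List.mem_toFinset.2 h.2.1⟩

/-- The list form of `finalElections`. -/
def finalList (p : ℕ) : ControlAction → ListInput → List (List ℕ × List (List ℕ × ℕ))
  | .PV t, .partition C V => (voteSplits V).map fun s =>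
      (survivorList t (r.winnerList C s.1) ++ survivorList t (r.winnerList C s.2), V)
  | .PC t, .partition C V => (candSplits C).map fun s =>
      (survivorList t (r.winnerList s.1 V) ++ s.2, V)
  | .RPC t, .partition C V => (candSplits C).map fun s =>
      (survivorList t (r.winnerList s.1 V) ++ survivorList t (r.winnerList s.2 V), V)
  | .AC, .addCandidates C A V k =>
      ((candSplits A).filter fun s => Nat.ble s.1.length k).map fun s => (C ++ s.1, V)
  | .UAC, .addCandidatesUnlimited C A V => (candSplits A).map fun s => (C ++ s.1, V)
  | .DC, .delete C V k =>
      ((candSplits C).filter fun s => Nat.ble s.1.length k && hasElem s.2 p).map fun s => (s.2, V)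
  | .DV, .delete C V k =>
      ((voteSplits V).filter fun s => Nat.ble (voteCount s.1) k).map fun s => (C, s.2)
  | .AV, .addVoters C V W k =>
      ((voteSplits W).filter fun s => Nat.ble (voteCount s.1) k).map fun s => (C, V ++ s.1)
  | _, _ => []

theorem toFinset_survivorList_winnerList (t : TieRule) (D : List ℕ) (L : List (List ℕ × ℕ)) :
    (survivorList t (r.winnerList D L)).toFinset =
      t.survivors (E.elect D.toFinset (r.votes L)) := by
  rw [toFinset_survivorList, toFinset_winnerList]

end PointRule

theorem expand_append {α : Type} : ∀ L L' : List (α × ℕ), expand (L ++ L') = expand L + expand L'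
  | [], L' => (zero_add _).symm
  | x :: L, L' => by
    rw [List.cons_append, expand, expand, expand_append L L', add_assoc]

theorem nodup_of_mem_candSplits : ∀ {l : List ℕ} {s : List ℕ × List ℕ}, l.Nodup →
    s ∈ candSplits l → s.1.Nodup ∧ (∀ c ∈ s.1, c ∈ l)
  | [], s, _, h => by
    obtain rfl := List.mem_singleton.1 h
    simp
  | c :: l, s, hl, h => by
    simp only [candSplits, List.mem_flatMap, List.mem_cons, List.not_mem_nil, or_false] at h
    rw [List.nodup_cons] at hl
    obtain ⟨s', hs', rfl | rfl⟩ := h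
    · have h' := nodup_of_mem_candSplits hl.2 hs'
      refine ⟨List.nodup_cons.2 ⟨fun hc => hl.1 (h'.2 c hc), h'.1⟩, fun x hx => ?_⟩
      rcases List.mem_cons.1 hx with rfl | hx
      · exact List.mem_cons_self
      · exact List.mem_cons_of_mem _ (h'.2 x hx)
    · have h' := nodup_of_mem_candSplits hl.2 hs'
      exact ⟨h'.1, fun x hx => List.mem_cons_of_mem _ (h'.2 x hx)⟩

theorem card_of_mem_candSplits {l : List ℕ} {s : List ℕ × List ℕ} (hl : l.Nodup)
    (h : s ∈ candSplits l) : s.1.toFinset.card = s.1.length :=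
  List.toFinset_card_of_nodup (nodup_of_mem_candSplits hl h).1

/-- The first parts of the splits of a list of candidates are its subsets, the second parts their
complements. -/
theorem subset_iff_candSplits {l : List ℕ} (hl : l.Nodup) {A : Finset ℕ} :
    A ⊆ l.toFinset ↔
      ∃ s ∈ candSplits l, A = s.1.toFinset ∧ l.toFinset \ A = s.2.toFinset := by
  constructor
  · intro h
    exact (partition_iff_candSplits hl).1
      ⟨Finset.union_sdiff_of_subset h, Finset.disjoint_sdiff⟩
  · rintro ⟨s, hs, rfl, -⟩
    rw [← union_of_mem_candSplits hs]
    exact Finset.subset_union_left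

namespace PointRule

variable {E : ElectionSystem} (r : PointRule E)

theorem mem_finalElections_iff {p : ℕ} {I : ListInput} (h : r.validInput p I = true)
    (a : ControlAction) (e : Finset ℕ × Multiset E.Ballot) :
    e ∈ finalElections E p a (r.input I) ↔
      ∃ f ∈ r.finalList p a I, e = (f.1.toFinset, r.votes f.2) := by
  cases I with
  | partition C V =>
    simp only [validInput, Bool.and_eq_true, decide_eq_true_eq, hasElem_iff] at h
    cases a with
    | PV t =>
      simp only [finalList, List.mem_map, input, finalElections, Set.mem_ofPred_eq]
      constructor
      · rintro ⟨V₁, V₂, hV, rfl⟩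
        obtain ⟨s, hs, rfl, rfl⟩ := (add_eq_map_expand_iff _ _ _ _).1 hV
        refine ⟨_, ⟨s, hs, rfl⟩, ?_⟩
        rw [List.toFinset_append, toFinset_survivorList_winnerList,
          toFinset_survivorList_winnerList]
        rfl
      · rintro ⟨_, ⟨s, hs, rfl⟩, rfl⟩
        refine ⟨r.votes s.1, r.votes s.2,
          (add_eq_map_expand_iff _ _ _ _).2 ⟨s, hs, rfl, rfl⟩, ?_⟩
        rw [List.toFinset_append, toFinset_survivorList_winnerList,
          toFinset_survivorList_winnerList]
    | PC t =>
      simp only [finalList, List.mem_map, input, finalElections, Set.mem_ofPred_eq]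
      constructor
      · rintro ⟨C₁, C₂, hu, hd, rfl⟩
        obtain ⟨s, hs, rfl, rfl⟩ := (partition_iff_candSplits h.1).1 ⟨hu, hd⟩
        exact ⟨_, ⟨s, hs, rfl⟩, by
          rw [List.toFinset_append, toFinset_survivorList_winnerList]⟩
      · rintro ⟨_, ⟨s, hs, rfl⟩, rfl⟩
        obtain ⟨hu, hd⟩ := (partition_iff_candSplits h.1).2 ⟨s, hs, rfl, rfl⟩
        exact ⟨_, _, hu, hd, by
          rw [List.toFinset_append, toFinset_survivorList_winnerList]⟩
    | RPC t =>
      simp only [finalList, List.mem_map, input, finalElections, Set.mem_ofPred_eq]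
      constructor
      · rintro ⟨C₁, C₂, hu, hd, rfl⟩
        obtain ⟨s, hs, rfl, rfl⟩ := (partition_iff_candSplits h.1).1 ⟨hu, hd⟩
        exact ⟨_, ⟨s, hs, rfl⟩, by
          rw [List.toFinset_append, toFinset_survivorList_winnerList,
            toFinset_survivorList_winnerList]⟩
      · rintro ⟨_, ⟨s, hs, rfl⟩, rfl⟩
        obtain ⟨hu, hd⟩ := (partition_iff_candSplits h.1).2 ⟨s, hs, rfl, rfl⟩
        exact ⟨_, _, hu, hd, by
          rw [List.toFinset_append, toFinset_survivorList_winnerList,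
            toFinset_survivorList_winnerList]⟩
    | _ => simp [finalList, input, finalElections]
  | addCandidates C A V k =>
    simp only [validInput, Bool.and_eq_true, decide_eq_true_eq, hasElem_iff] at h
    have hA : A.Nodup := (List.nodup_append.1 h.1).2.1
    cases a with
    | AC =>
      simp only [finalList, List.mem_map, List.mem_filter, Nat.ble_eq, input, finalElections,
        Set.mem_ofPred_eq]
      constructor
      · rintro ⟨A', hsub, hk, rfl⟩
        obtain ⟨s, hs, rfl, -⟩ := (subset_iff_candSplits hA).1 hsub
        rw [card_of_mem_candSplits hA hs] at hk
        exact ⟨_, ⟨s, ⟨hs, hk⟩, rfl⟩, by rw [List.toFinset_append]⟩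
      · rintro ⟨_, ⟨s, ⟨hs, hk⟩, rfl⟩, rfl⟩
        rw [← card_of_mem_candSplits hA hs] at hk
        refine ⟨s.1.toFinset, ?_, hk, by rw [List.toFinset_append]⟩
        rw [← union_of_mem_candSplits hs]
        exact Finset.subset_union_left
    | _ => simp [finalList, input, finalElections]
  | addCandidatesUnlimited C A V =>
    simp only [validInput, Bool.and_eq_true, decide_eq_true_eq, hasElem_iff] at h
    have hA : A.Nodup := (List.nodup_append.1 h.1).2.1
    cases a with
    | UAC =>
      simp only [finalList, List.mem_map, input, finalElections, Set.mem_ofPred_eq]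
      constructor
      · rintro ⟨A', hsub, rfl⟩
        obtain ⟨s, hs, rfl, -⟩ := (subset_iff_candSplits hA).1 hsub
        exact ⟨_, ⟨s, hs, rfl⟩, by rw [List.toFinset_append]⟩
      · rintro ⟨_, ⟨s, hs, rfl⟩, rfl⟩
        refine ⟨s.1.toFinset, ?_, by rw [List.toFinset_append]⟩
        rw [← union_of_mem_candSplits hs]
        exact Finset.subset_union_left
    | _ => simp [finalList, input, finalElections]
  | delete C V k =>
    simp only [validInput, Bool.and_eq_true, decide_eq_true_eq, hasElem_iff] at h
    cases a with
    | DC =>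
      simp only [finalList, List.mem_map, List.mem_filter, Bool.and_eq_true, Nat.ble_eq,
        hasElem_iff, input, finalElections, Set.mem_ofPred_eq]
      constructor
      · rintro ⟨C', hsub, hk, hp, rfl⟩
        obtain ⟨s, hs, rfl, hs2⟩ := (subset_iff_candSplits h.1).1 hsub
        rw [card_of_mem_candSplits h.1 hs] at hk
        refine ⟨_, ⟨s, ⟨hs, hk, ?_⟩, rfl⟩, by rw [hs2]⟩
        rw [← List.mem_toFinset, ← hs2, Finset.mem_sdiff, List.mem_toFinset]
        exact ⟨h.2.1, hp⟩
      · rintro ⟨_, ⟨s, ⟨hs, hk, hp⟩, rfl⟩, rfl⟩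
        rw [← card_of_mem_candSplits h.1 hs] at hk
        have hu := union_of_mem_candSplits hs
        have hd := disjoint_of_mem_candSplits h.1 hs
        refine ⟨s.1.toFinset, hu ▸ Finset.subset_union_left, hk, fun hp' => ?_, ?_⟩
        · exact Finset.disjoint_left.1 hd hp' (List.mem_toFinset.2 hp)
        · rw [← hu, Finset.union_sdiff_cancel_left hd]
    | DV =>
      simp only [finalList, List.mem_map, List.mem_filter, Nat.ble_eq, input, finalElections,
        Set.mem_ofPred_eq]
      constructor
      · rintro ⟨V', R, hV, hk, rfl⟩
        obtain ⟨s, hs, rfl, rfl⟩ := (add_eq_map_expand_iff _ _ _ _).1 hV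
        rw [Multiset.card_map, card_expand] at hk
        exact ⟨_, ⟨s, ⟨hs, hk⟩, rfl⟩, rfl⟩
      · rintro ⟨_, ⟨s, ⟨hs, hk⟩, rfl⟩, rfl⟩
        refine ⟨r.votes s.1, r.votes s.2,
          (add_eq_map_expand_iff _ _ _ _).2 ⟨s, hs, rfl, rfl⟩, ?_, rfl⟩
        rw [votes, Multiset.card_map, card_expand]
        exact hk
    | _ => simp [finalList, input, finalElections]
  | addVoters C V W k =>
    cases a with
    | AV =>
      have hadd (L : List (List ℕ × ℕ)) : r.votes (V ++ L) = r.votes V + r.votes L := by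
        rw [votes, expand_append, Multiset.map_add]
        rfl
      simp only [finalList, List.mem_map, List.mem_filter, Nat.ble_eq, input, finalElections,
        Set.mem_ofPred_eq]
      constructor
      · rintro ⟨W', hW, hk, rfl⟩
        obtain ⟨R, hR⟩ := Multiset.le_iff_exists_add.1 hW
        obtain ⟨s, hs, rfl, -⟩ := (add_eq_map_expand_iff _ _ _ _).1 hR.symm
        rw [Multiset.card_map, card_expand] at hk
        exact ⟨_, ⟨s, ⟨hs, hk⟩, rfl⟩, by rw [hadd]; rfl⟩
      · rintro ⟨_, ⟨s, ⟨hs, hk⟩, rfl⟩, rfl⟩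
        have hs' : r.votes s.1 + r.votes s.2 = r.votes W :=
          (add_eq_map_expand_iff _ _ _ _).2 ⟨s, hs, rfl, rfl⟩
        refine ⟨r.votes s.1, hs' ▸ Multiset.le_add_right _ _, ?_, by rw [hadd]⟩
        rw [votes, Multiset.card_map, card_expand]
        exact hk
    | _ => simp [finalList, input, finalElections]

end PointRule

/-- The list form of `ControlType.GoalMet`. -/
def goalTest (T : ControlType) (W : List ℕ) (p : ℕ) : Bool :=
  let won := match T.model with
    | .UW => isOnly p W
    | .NUW => hasElem W p
  match T.goal with
  | .constructive => won
  | .destructive => !won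

theorem goalTest_iff {T : ControlType} {W : List ℕ} {p : ℕ} :
    goalTest T W p = true ↔ T.GoalMet W.toFinset p := by
  obtain ⟨g, a, m⟩ := T
  cases g <;> cases m <;>
    simp [goalTest, ControlType.GoalMet, WinnerModel.Wins, ← isOnly_iff, hasElem_iff,
      ← Bool.not_eq_true]

/-- A list input with a focus candidate, together with types for which it is claimed to be a yes
instance and types for which it is claimed not to be. If the claims are true, then no type in `yes`
is contained in a type in `no`. -/
structure Witness where
  input : ListInput
  focus : ℕ
  yes : List ControlType
  no : List ControlType

namespace PointRule

variable {E : ElectionSystem} (r : PointRule E)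

/-- Control of type `T` succeeds on a list input with focus candidate `p`. -/
def succeeds (I : ListInput) (p : ℕ) (T : ControlType) : Bool :=
  (r.finalList p T.action I).any fun f => goalTest T (r.winnerList f.1 f.2) p

theorem succeeds_iff {I : ListInput} {p : ℕ} (h : r.validInput p I = true) (T : ControlType) :
    r.succeeds I p T = true ↔ p ∈ successSet E T (r.input I) := by
  have hmem : p ∈ successSet E T (r.input I) ↔
      ∃ e ∈ finalElections E p T.action (r.input I), T.GoalMet (E.elect e.1 e.2) p :=
    ⟨fun h' => h'.2, fun h' => ⟨r.wellFormed_of_validInput h, h'⟩⟩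
  rw [hmem, succeeds, List.any_eq_true]
  simp only [goalTest_iff, toFinset_winnerList, r.mem_finalElections_iff h]
  constructor
  · rintro ⟨f, hf, hg⟩
    exact ⟨_, ⟨f, hf, rfl⟩, hg⟩
  · rintro ⟨_, ⟨f, hf, rfl⟩, hg⟩
    exact ⟨f, hf, hg⟩

/-- The claims of the witness are true. -/
def check (w : Witness) : Bool :=
  r.validInput w.focus w.input &&
    (w.yes.all (r.succeeds w.input w.focus) &&
      w.no.all (fun T => !r.succeeds w.input w.focus T))

theorem exists_diff_of_check {w : Witness} (h : r.check w = true) {T T' : ControlType}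
    (hT : T ∈ w.yes) (hT' : T' ∈ w.no) :
    ∃ R, (successSet E T R \ successSet E T' R).Nonempty := by
  simp only [check, Bool.and_eq_true, List.all_eq_true, Bool.not_eq_true'] at h
  refine ⟨r.input w.input, w.focus, (r.succeeds_iff h.1 T).1 (h.2.1 T hT), fun h' => ?_⟩
  rw [← r.succeeds_iff h.1, h.2.2 T' hT'] at h'
  exact Bool.false_ne_true h'

end PointRule

/-! ### Witnesses -/

section Witnesses

open ControlAction TieRule WinnerModel

/-- Alone, candidate `0` is the only winner whatever the chair does. Against candidate `1`, for whom
the only vote `v` is cast, it can be kept from winning, but it cannot be made a winner. The actions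
are `as`, and `mk C V` is an input in which the chair can do no more than partition `C` or `V`. -/
def trivialWitnesses (v : List ℕ) (mk : List ℕ → List (List ℕ × ℕ) → ListInput)
    (as : List ControlAction) : List Witness :=
  let ccs := as.flatMap fun a => [cc a UW, cc a NUW]
  let dcs := as.flatMap fun a => [dc a UW, dc a NUW]
  [⟨mk [0] [], 0, ccs, dcs⟩, ⟨mk [0, 1] [(v, 1)], 0, dcs, ccs⟩]

/-- In addition to the trivial witnesses, two tied candidates in an election that the chair cannot
change: this separates the two winner models. -/
def tieWitnesses (v : List ℕ) (mk : List ℕ → List (List ℕ × ℕ) → ListInput)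
    (as : List ControlAction) : List Witness :=
  ⟨mk [0, 1] [], 0, as.flatMap fun a => [cc a NUW, dc a UW],
    as.flatMap fun a => [cc a UW, dc a NUW]⟩ :: trivialWitnesses v mk as

/-- Witnesses common to the three election systems, where `v` encodes a vote for candidate `1`
against candidate `0`. Among the partition types they separate constructive from destructive ones;
for the other actions the limit is `0`, or there is nothing to add. -/
def uniformWitnesses (v : List ℕ) : List Witness :=
  trivialWitnesses v .partition [PV TE, PV TP, PC TE, PC TP, RPC TE, RPC TP] ++
    (tieWitnesses v (fun C V => .addCandidates C [] V 0) [AC] ++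
    (tieWitnesses v (fun C V => .addCandidatesUnlimited C [] V) [UAC] ++
    (tieWitnesses v (fun C V => .addVoters C V [] 0) [AV] ++
    tieWitnesses v (fun C V => .delete C V 0) [DC, DV])))

/-- Partition inputs under plurality. -/
def pluralityPartitionWitnesses : List Witness :=
  [⟨.partition [0, 1]
      [([1, 0], 1), ([0, 1], 1)], 0,
      [cc (PV TE) NUW, cc (PV TP) NUW, cc (PC TE) NUW, cc (PC TP) NUW, cc (RPC TE) NUW,
        cc (RPC TP) NUW],
      [cc (PV TE) UW, cc (PV TP) UW, cc (PC TE) UW, cc (PC TP) UW, cc (RPC TE) UW,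
        cc (RPC TP) UW]⟩,
    ⟨.partition [0, 1, 2]
      [([2, 0, 1], 1), ([1, 2, 0], 1)], 0,
      [cc (PC TE) UW, cc (PC TE) NUW, cc (RPC TE) UW, cc (RPC TE) NUW],
      [cc (PV TE) UW, cc (PV TE) NUW, cc (PV TP) UW, cc (PV TP) NUW, cc (PC TP) UW,
        cc (PC TP) NUW, cc (RPC TP) UW, cc (RPC TP) NUW]⟩,
    ⟨.partition [0, 1, 2, 3]
      [([3, 0, 1, 2], 1), ([1, 2, 0, 3], 1), ([2, 0, 3, 1], 1)], 0,
      [cc (PC TP) NUW, cc (RPC TP) UW, cc (RPC TP) NUW],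
      [cc (PV TE) UW, cc (PV TE) NUW, cc (PV TP) UW, cc (PV TP) NUW, cc (PC TP) UW]⟩,
    ⟨.partition [0, 1, 2]
      [([0, 2, 1], 1), ([1, 0, 2], 2), ([2, 0, 1], 2)], 2,
      [cc (PV TE) UW, cc (PV TE) NUW, cc (PV TP) UW, cc (PV TP) NUW, cc (PC TE) NUW,
        cc (PC TP) UW, cc (PC TP) NUW, cc (RPC TP) UW, cc (RPC TP) NUW],
      [cc (PC TE) UW, cc (RPC TE) UW, cc (RPC TE) NUW]⟩,
    ⟨.partition [0, 1, 2]
      [([1, 0, 2], 3), ([2, 0, 1], 2), ([0, 2, 1], 2)], 2,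
      [cc (PV TE) UW, cc (PV TE) NUW, cc (PV TP) UW, cc (PV TP) NUW],
      [cc (PC TE) NUW, cc (PC TP) UW, cc (PC TP) NUW, cc (RPC TP) UW, cc (RPC TP) NUW]⟩,
    ⟨.partition [0, 1, 2, 3]
      [([0, 3, 2, 1], 3), ([1, 0, 2, 3], 2), ([2, 3, 1, 0], 2)], 2,
      [cc (PV TE) UW, cc (PV TE) NUW, cc (RPC TE) UW, cc (RPC TE) NUW, cc (RPC TP) UW,
        cc (RPC TP) NUW],
      [cc (PV TP) UW, cc (PV TP) NUW, cc (PC TE) UW, cc (PC TE) NUW, cc (PC TP) NUW]⟩,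
    ⟨.partition [0, 1, 2, 3]
      [([0, 3, 2, 1], 3), ([1, 0, 2, 3], 2), ([2, 3, 1, 0], 2)], 3,
      [cc (PC TE) UW, cc (PC TP) UW, cc (PC TP) NUW],
      [cc (PV TE) UW, cc (PV TE) NUW, cc (PV TP) UW, cc (PV TP) NUW, cc (RPC TE) UW,
        cc (RPC TE) NUW, cc (RPC TP) UW, cc (RPC TP) NUW]⟩,
    ⟨.partition [0, 1, 2, 3, 4]
      [([4, 2, 1, 3, 0], 2), ([2, 0, 1, 3, 4], 2), ([0, 4, 1, 3, 2], 1), ([3, 1, 4, 0, 2], 1),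
        ([1, 2, 4, 3, 0], 2)], 0,
      [cc (PC TP) UW, cc (PC TP) NUW],
      [cc (PC TE) NUW]⟩,
    ⟨.partition [0, 1, 2, 3, 4]
      [([3, 1, 2, 0, 4], 4), ([0, 1, 2, 3, 4], 2), ([2, 4, 0, 1, 3], 1), ([4, 0, 3, 1, 2], 1),
        ([1, 4, 2, 0, 3], 3)], 4,
      [cc (PV TP) UW, cc (PV TP) NUW],
      [cc (PV TE) UW, cc (PV TE) NUW]⟩,
    ⟨.partition [0, 1, 2]
      [([1, 2, 0], 1), ([2, 0, 1], 2), ([0, 2, 1], 2)], 2,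
      [dc (PV TE) UW, dc (PV TE) NUW, dc (PV TP) UW, dc (PC TE) UW, dc (PC TE) NUW,
        dc (PC TP) UW, dc (RPC TE) UW, dc (RPC TE) NUW],
      [dc (PV TP) NUW, dc (PC TP) NUW, dc (RPC TP) UW, dc (RPC TP) NUW]⟩,
    ⟨.partition [0, 1, 2, 3]
      [([0, 2, 3, 1], 2), ([1, 2, 3, 0], 2), ([3, 1, 2, 0], 3)], 3,
      [dc (PV TE) UW, dc (PV TE) NUW, dc (PC TE) UW, dc (PC TE) NUW, dc (PC TP) UW,
        dc (PC TP) NUW, dc (RPC TE) UW, dc (RPC TE) NUW, dc (RPC TP) UW, dc (RPC TP) NUW],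
      [dc (PV TP) UW, dc (PV TP) NUW]⟩,
    ⟨.partition [0, 1, 2, 3]
      [([2, 3, 0, 1], 3), ([0, 1, 2, 3], 1), ([3, 1, 2, 0], 1), ([1, 0, 3, 2], 1)], 2,
      [dc (PV TE) UW, dc (PV TP) UW, dc (PC TE) UW, dc (PC TE) NUW, dc (PC TP) UW,
        dc (RPC TE) UW, dc (RPC TE) NUW, dc (RPC TP) UW],
      [dc (PV TE) NUW, dc (PC TP) NUW, dc (RPC TP) NUW]⟩,
    ⟨.partition [0, 1, 2, 3, 4]
      [([0, 3, 4, 1, 2], 4), ([3, 0, 4, 1, 2], 3), ([4, 0, 2, 3, 1], 3)], 0,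
      [dc (PV TE) UW, dc (PV TE) NUW, dc (PV TP) UW, dc (PV TP) NUW],
      [dc (PC TE) UW, dc (PC TE) NUW, dc (PC TP) UW, dc (PC TP) NUW, dc (RPC TE) UW,
        dc (RPC TE) NUW, dc (RPC TP) UW, dc (RPC TP) NUW]⟩,
    ⟨.partition [0, 1, 2, 3, 4]
      [([3, 2, 4, 0, 1], 1), ([4, 1, 0, 3, 2], 2), ([4, 3, 2, 0, 1], 1), ([0, 2, 1, 4, 3], 1),
        ([1, 3, 4, 0, 2], 1), ([2, 3, 4, 0, 1], 1)], 4,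
      [dc (PV TP) UW, dc (PC TE) UW, dc (PC TE) NUW, dc (RPC TE) UW, dc (RPC TE) NUW,
        dc (RPC TP) UW],
      [dc (PV TE) UW, dc (PC TP) UW]⟩,
    ⟨.partition [0, 1, 2, 3, 4]
      [([2, 4, 0, 1, 3], 2), ([4, 3, 2, 1, 0], 2), ([1, 3, 0, 2, 4], 2), ([3, 0, 1, 4, 2], 2),
        ([0, 3, 1, 4, 2], 5)], 0,
      [dc (PV TP) NUW, dc (PC TP) UW, dc (PC TP) NUW, dc (RPC TP) NUW],
      [dc (PV TE) UW, dc (PV TE) NUW]⟩]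

/-- Partition inputs under veto. -/
def vetoPartitionWitnesses : List Witness :=
  [⟨.partition [0, 1]
      [([1, 0], 1), ([0, 1], 1)], 0,
      [cc (PV TE) NUW, cc (PV TP) NUW, cc (PC TE) NUW, cc (PC TP) NUW, cc (RPC TE) NUW,
        cc (RPC TP) NUW],
      [cc (PV TE) UW, cc (PV TP) UW, cc (PC TE) UW, cc (PC TP) UW, cc (RPC TE) UW,
        cc (RPC TP) UW]⟩,
    ⟨.partition [0, 1, 2]
      [([2, 0, 1], 1), ([1, 2, 0], 1)], 0,
      [cc (PC TE) UW, cc (PC TE) NUW, cc (RPC TE) UW, cc (RPC TE) NUW],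
      [cc (PV TE) UW, cc (PV TE) NUW, cc (PV TP) UW, cc (PV TP) NUW, cc (PC TP) UW,
        cc (PC TP) NUW, cc (RPC TP) UW, cc (RPC TP) NUW]⟩,
    ⟨.partition [0, 1, 2, 3]
      [([0, 2, 1, 3], 3), ([3, 1, 2, 0], 2)], 1,
      [cc (PV TP) UW, cc (PV TP) NUW, cc (PC TE) UW, cc (PC TE) NUW, cc (PC TP) UW,
        cc (PC TP) NUW],
      [cc (PV TE) UW, cc (PV TE) NUW, cc (RPC TE) UW, cc (RPC TE) NUW, cc (RPC TP) UW,
        cc (RPC TP) NUW]⟩,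
    ⟨.partition [0, 1, 2, 3, 4]
      [([2, 4, 3, 0, 1], 1), ([4, 1, 0, 2, 3], 1), ([3, 2, 0, 1, 4], 1)], 0,
      [cc (PC TP) UW, cc (RPC TP) UW, cc (RPC TP) NUW],
      [cc (PV TE) UW, cc (PV TE) NUW, cc (PV TP) UW, cc (RPC TE) UW, cc (RPC TE) NUW]⟩,
    ⟨.partition [0, 1, 2]
      [([0, 1, 2], 2), ([2, 1, 0], 2), ([2, 0, 1], 1)], 0,
      [cc (PV TE) UW, cc (PV TE) NUW, cc (PV TP) UW, cc (PV TP) NUW],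
      [cc (PC TE) UW, cc (PC TE) NUW, cc (PC TP) UW, cc (PC TP) NUW, cc (RPC TE) UW,
        cc (RPC TE) NUW, cc (RPC TP) UW, cc (RPC TP) NUW]⟩,
    ⟨.partition [0, 1, 2]
      [([2, 0, 1], 2), ([0, 1, 2], 2), ([1, 2, 0], 1)], 1,
      [cc (PV TE) UW, cc (PV TE) NUW, cc (PC TP) UW, cc (PC TP) NUW, cc (RPC TP) UW,
        cc (RPC TP) NUW],
      [cc (PV TP) UW, cc (PV TP) NUW]⟩,
    ⟨.partition [0, 1, 2, 3]
      [([1, 0, 3, 2], 2), ([3, 1, 2, 0], 1), ([0, 3, 2, 1], 2)], 1,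
      [cc (RPC TE) UW, cc (RPC TE) NUW, cc (RPC TP) UW, cc (RPC TP) NUW],
      [cc (PC TE) UW, cc (PC TE) NUW, cc (PC TP) UW, cc (PC TP) NUW]⟩,
    ⟨.partition [0, 1, 2, 3, 4]
      [([2, 0, 3, 4, 1], 1), ([2, 3, 4, 1, 0], 2), ([4, 2, 0, 1, 3], 2), ([4, 3, 0, 1, 2], 2)], 1,
      [cc (PC TP) UW, cc (PC TP) NUW],
      [cc (PC TE) UW, cc (PC TE) NUW]⟩,
    ⟨.partition [0, 1, 2]
      [([1, 0, 2], 1)], 1,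
      [dc (PV TE) UW, dc (PV TE) NUW, dc (PV TP) UW, dc (PC TE) UW, dc (PC TE) NUW,
        dc (PC TP) UW, dc (RPC TE) UW, dc (RPC TE) NUW],
      [dc (PV TP) NUW, dc (PC TP) NUW, dc (RPC TP) UW, dc (RPC TP) NUW]⟩,
    ⟨.partition [0, 1, 2, 3]
      [([3, 0, 1, 2], 1), ([1, 2, 0, 3], 1), ([2, 0, 3, 1], 1)], 0,
      [dc (PV TE) UW, dc (PV TE) NUW, dc (PC TE) UW, dc (PC TE) NUW, dc (PC TP) UW,
        dc (PC TP) NUW, dc (RPC TE) UW, dc (RPC TE) NUW, dc (RPC TP) UW, dc (RPC TP) NUW],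
      [dc (PV TP) UW, dc (PV TP) NUW]⟩,
    ⟨.partition [0, 1, 2, 3]
      [([2, 1, 3, 0], 2), ([0, 3, 1, 2], 1), ([1, 0, 2, 3], 1)], 1,
      [dc (PV TE) UW, dc (PV TE) NUW, dc (PC TE) UW, dc (PC TE) NUW, dc (RPC TE) UW,
        dc (RPC TE) NUW, dc (RPC TP) UW],
      [dc (PC TP) UW, dc (PC TP) NUW, dc (RPC TP) NUW]⟩,
    ⟨.partition [0, 1, 2]
      [([0, 2, 1], 2), ([1, 2, 0], 3), ([1, 0, 2], 3)], 1,
      [dc (PV TE) UW, dc (PV TE) NUW, dc (PV TP) UW, dc (PV TP) NUW],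
      [dc (PC TE) UW, dc (PC TE) NUW, dc (PC TP) UW, dc (PC TP) NUW, dc (RPC TE) UW,
        dc (RPC TE) NUW, dc (RPC TP) UW, dc (RPC TP) NUW]⟩]

/-- Partition inputs under approval. -/
def approvalPartitionWitnesses : List Witness :=
  [⟨.partition [0, 1, 2]
      [], 0,
      [cc (PV TP) NUW, cc (PC TE) UW, cc (PC TE) NUW, cc (PC TP) NUW, cc (RPC TE) UW,
        cc (RPC TE) NUW, cc (RPC TP) NUW],
      [cc (PV TE) UW, cc (PV TE) NUW, cc (PV TP) UW, cc (PC TP) UW, cc (RPC TP) UW]⟩,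
    ⟨.partition [0, 1]
      [([0], 1), ([1], 1)], 0,
      [cc (PV TE) NUW, cc (PV TP) NUW, cc (PC TE) NUW, cc (PC TP) NUW, cc (RPC TE) NUW,
        cc (RPC TP) NUW],
      [cc (PV TE) UW, cc (PV TP) UW, cc (PC TE) UW, cc (PC TP) UW, cc (RPC TE) UW,
        cc (RPC TP) UW]⟩,
    ⟨.partition [0, 1, 2]
      [([0, 2], 2), ([1], 1)], 1,
      [cc (PV TE) UW, cc (PV TE) NUW, cc (PC TE) UW, cc (PC TE) NUW, cc (RPC TE) UW,
        cc (RPC TE) NUW],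
      [cc (PV TP) UW, cc (PV TP) NUW, cc (PC TP) UW, cc (PC TP) NUW, cc (RPC TP) UW,
        cc (RPC TP) NUW]⟩,
    ⟨.partition [0, 1, 2]
      [([2], 1), ([0, 1], 2), ([0, 2], 3), ([1], 1)], 2,
      [cc (PV TE) UW, cc (PV TE) NUW, cc (PV TP) UW, cc (PV TP) NUW],
      [cc (PC TE) UW, cc (PC TE) NUW, cc (PC TP) UW, cc (PC TP) NUW, cc (RPC TE) UW,
        cc (RPC TE) NUW, cc (RPC TP) UW, cc (RPC TP) NUW]⟩,
    -- Candidates 1, 5 and 6 beat 0 in the whole election. If the votes {0, 2, 3} and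
    -- {0, 1, 2, 3, 5, 6} form one half, then 0 ties there with 2 and 3, and 4 wins the other half,
    -- so that 0 is the only winner against 2, 3 and 4 if ties promote. To win a half alone, 0 needs
    -- in it both {0, 2, 4, 5, 6} and {0, 3, 4, 5, 6}, against 2 and 3, hence also {0, 2, 3} and
    -- no {1, 5} or {1, 6}, against 5 and 6; then 1 is the only winner of the other half and beats 0.
    ⟨.partition [0, 1, 2, 3, 4, 5, 6]
      [([0, 2, 3], 1), ([4], 3), ([1, 5], 2), ([1, 6], 2), ([0, 1, 2, 3, 5, 6], 3),
        ([0, 2, 4, 5, 6], 1), ([0, 3, 4, 5, 6], 1)], 0,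
      [cc (PV TP) UW],
      [cc (PV TE) UW, cc (PV TE) NUW]⟩,
    ⟨.partition [0, 1]
      [], 0,
      [dc (PV TE) UW, dc (PV TE) NUW, dc (PV TP) UW, dc (PC TE) UW, dc (PC TE) NUW,
        dc (PC TP) UW, dc (RPC TE) UW, dc (RPC TE) NUW, dc (RPC TP) UW],
      [dc (PV TP) NUW, dc (PC TP) NUW, dc (RPC TP) NUW]⟩,
    ⟨.partition [0, 1, 2]
      [([1, 2], 1), ([0, 1], 1)], 1,
      [dc (PV TE) UW, dc (PV TE) NUW],
      [dc (PV TP) UW, dc (PC TE) UW, dc (PC TE) NUW, dc (PC TP) UW, dc (RPC TE) UW,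
        dc (RPC TE) NUW, dc (RPC TP) UW]⟩,
    ⟨.partition [0, 1, 2]
      [([0, 2], 2), ([0], 1), ([1, 2], 2), ([1], 1)], 2,
      [dc (PV TP) UW, dc (PV TP) NUW],
      [dc (PC TE) UW, dc (PC TE) NUW, dc (PC TP) UW, dc (PC TP) NUW, dc (RPC TE) UW,
        dc (RPC TE) NUW, dc (RPC TP) UW, dc (RPC TP) NUW]⟩]

/-- Inputs that separate deleting candidates from deleting voters under plurality. -/
def pluralityDeleteWitnesses : List Witness :=
  [⟨.delete [0, 1] [([0, 1], 2)] 1, 1, [cc DC UW, cc DC NUW], [cc DV UW, cc DV NUW]⟩,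
    ⟨.delete [0, 1, 2, 3] [([3, 1, 0, 2], 1), ([1, 2, 0, 3], 2)] 2, 3,
      [cc DV UW, cc DV NUW], [cc DC UW, cc DC NUW]⟩,
    ⟨.delete [0, 1] [([1, 0], 2), ([0, 1], 1)] 2, 1, [dc DV UW, dc DV NUW], [dc DC UW, dc DC NUW]⟩,
    ⟨.delete [0, 1, 2] [([0, 1, 2], 5), ([1, 2, 0], 3), ([2, 1, 0], 3)] 1, 0,
      [dc DC UW, dc DC NUW], [dc DV UW, dc DV NUW]⟩]

/-- Inputs that separate deleting candidates from deleting voters under veto. -/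
def vetoDeleteWitnesses : List Witness :=
  [⟨.delete [0, 1] [([0, 1], 2)] 1, 1, [cc DC UW, cc DC NUW], [cc DV UW, cc DV NUW]⟩,
    ⟨.delete [0, 1, 2, 3] [([0, 2, 3, 1], 1), ([2, 3, 1, 0], 1), ([3, 2, 0, 1], 1),
      ([0, 1, 2, 3], 1), ([0, 3, 1, 2], 1)] 2, 1, [cc DV UW, cc DV NUW], [cc DC UW, cc DC NUW]⟩,
    ⟨.delete [0, 1] [([0, 1], 1), ([1, 0], 2)] 2, 1, [dc DV UW, dc DV NUW], [dc DC UW, dc DC NUW]⟩,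
    ⟨.delete [0, 1, 2] [([0, 1, 2], 3), ([2, 1, 0], 1), ([1, 2, 0], 1)] 1, 1,
      [dc DC UW, dc DC NUW], [dc DV UW, dc DV NUW]⟩]

/-- Inputs that separate deleting candidates from deleting voters under approval, except where a
containment holds. -/
def approvalDeleteWitnesses : List Witness :=
  [⟨.delete [0, 1] [([0], 2)] 1, 1, [cc DC UW, cc DC NUW], [cc DV UW, cc DV NUW]⟩,
    ⟨.delete [0, 1, 2, 3] [([1, 2, 3], 2), ([0], 1)] 2, 0,
      [cc DV UW, cc DV NUW], [cc DC UW, cc DC NUW]⟩,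
    ⟨.delete [0, 1] [([0], 1), ([1], 2)] 2, 1, [dc DV UW, dc DV NUW], [dc DC UW, dc DC NUW]⟩]

end Witnesses

theorem check_pluralityPartitionWitnesses :
    pluralityPartitionWitnesses.all pluralityRule.check = true := by
  decide +kernel

theorem check_vetoPartitionWitnesses :
    vetoPartitionWitnesses.all vetoRule.check = true := by
  decide +kernel

theorem check_approvalPartitionWitnesses :
    approvalPartitionWitnesses.all approvalRule.check = true := by
  decide +kernel

/-- All witnesses for plurality. -/
def pluralityWitnesses : List Witness :=
  pluralityPartitionWitnesses ++ (pluralityDeleteWitnesses ++ uniformWitnesses [1, 0])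

/-- All witnesses for veto. -/
def vetoWitnesses : List Witness :=
  vetoPartitionWitnesses ++ (vetoDeleteWitnesses ++ uniformWitnesses [1, 0])

/-- All witnesses for approval. -/
def approvalWitnesses : List Witness :=
  approvalPartitionWitnesses ++ (approvalDeleteWitnesses ++ uniformWitnesses [1])

theorem check_pluralityWitnesses : pluralityWitnesses.all pluralityRule.check = true := by
  rw [pluralityWitnesses, List.all_append, check_pluralityPartitionWitnesses]
  decide +kernel

theorem check_vetoWitnesses : vetoWitnesses.all vetoRule.check = true := by
  rw [vetoWitnesses, List.all_append, check_vetoPartitionWitnesses]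
  decide +kernel

theorem check_approvalWitnesses : approvalWitnesses.all approvalRule.check = true := by
  rw [approvalWitnesses, List.all_append, check_approvalPartitionWitnesses]
  decide +kernel

/-! ### From containments and witnesses to the classification -/

/-- All control types. -/
def allTypes : List ControlType :=
  [Goal.constructive, Goal.destructive].flatMap fun g =>
    [ControlAction.PV .TE, .PV .TP, .PC .TE, .PC .TP, .RPC .TE, .RPC .TP, .AC, .UAC, .DC, .AV,
      .DV].flatMap fun a => [⟨g, a, .UW⟩, ⟨g, a, .NUW⟩]

theorem mem_allTypes (T : ControlType) : T ∈ allTypes := by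
  obtain ⟨g, a, m⟩ := T
  rcases g with _ | _ <;> rcases m with _ | _ <;>
    rcases a with (_ | _) | (_ | _) | (_ | _) | _ | _ | _ | _ | _ <;> decide

theorem nodup_allTypes : allTypes.Nodup := by
  decide +kernel

instance : DecidableRel Compatible := fun T T' =>
  inferInstanceAs (Decidable (T.action.inputKind = T'.action.inputKind))

/-- The containments claimed by a classification table. -/
def ClassTable.le (K : ClassTable) (T T' : ControlType) : Bool :=
  K.sameClass T T' || K.isBelow T T'

theorem ClassTable.subset_of_le {K : ClassTable} {E : ElectionSystem}
    (hc : ∀ c ∈ K.classes, ∀ T ∈ c, ∀ T' ∈ c, controlProblem E T ⊆ controlProblem E T')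
    (hb : ∀ b ∈ K.below, ∀ T ∈ b.1, ∀ T' ∈ b.2, controlProblem E T ⊆ controlProblem E T')
    {T T' : ControlType} (h : K.le T T' = true) : controlProblem E T ⊆ controlProblem E T' := by
  simp only [le, sameClass, isBelow, winnerModelBelow, Bool.or_eq_true, List.any_eq_true,
    decide_eq_true_eq] at h
  rcases h with ⟨c, hcK, hT, hT'⟩ | (⟨h, h'⟩ | ⟨h, h'⟩) | ⟨b, hbK, hT, hT'⟩
  · exact hc c hcK T hT T' hT'
  · rw [h, h']
    exact cc_UW_subset_NUW E _
  · rw [h, h']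
    exact dc_NUW_subset_UW E _
  · exact hb b hbK T hT T' hT'

/-- For distinct compatible types, the entries of the table agree with the containments that it
claims. -/
def ClassTable.Coherent (K : ClassTable) : Prop :=
  ∀ T ∈ allTypes, ∀ T' ∈ allTypes, T ≠ T' → Compatible T T' →
    match K.entry T T' with
    | .collapse => K.le T T' = true ∧ K.le T' T = true
    | .strictSubset => K.le T T' = true ∧ K.le T' T = false
    | .strictSuperset => K.le T T' = false ∧ K.le T' T = true
    | .incomparable => K.le T T' = false ∧ K.le T' T = false

/-- Each containment that the table denies is refuted by one of the witnesses. -/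
def ClassTable.RefutedBy (K : ClassTable) (ws : List Witness) : Prop :=
  ∀ T ∈ allTypes, ∀ T' ∈ allTypes, T ≠ T' → Compatible T T' → K.le T T' = false →
    ∃ w ∈ ws, T ∈ w.yes ∧ T' ∈ w.no

instance (K : ClassTable) (ws : List Witness) : Decidable (K.RefutedBy ws) := by
  unfold ClassTable.RefutedBy
  infer_instance

instance (K : ClassTable) : Decidable K.Coherent :=
  have (e : Entry) (p q r s : Prop) [Decidable p] [Decidable q] [Decidable r] [Decidable s] :
      Decidable (match e with
        | .collapse => p | .strictSubset => q | .strictSuperset => r | .incomparable => s) := by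
    cases e <;> infer_instance
  by
    unfold ClassTable.Coherent
    infer_instance

theorem coherent_plurality : pluralityTable.Coherent := by
  decide +kernel

theorem coherent_veto : vetoTable.Coherent := by
  decide +kernel

theorem coherent_approval : approvalTable.Coherent := by
  decide +kernel

theorem refutedBy_plurality : pluralityTable.RefutedBy pluralityWitnesses := by
  decide +kernel

theorem refutedBy_veto : vetoTable.RefutedBy vetoWitnesses := by
  decide +kernel

theorem refutedBy_approval : approvalTable.RefutedBy approvalWitnesses := by
  decide +kernel

theorem not_subset_of_diff {E : ElectionSystem} {T T' : ControlType}
    (h : ∃ R, (successSet E T R \ successSet E T' R).Nonempty) :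
    ¬ controlProblem E T ⊆ controlProblem E T' := by
  obtain ⟨R, c, hc, hc'⟩ := h
  exact fun hs => hc' (hs hc)

theorem entry_holds {E : ElectionSystem} (r : PointRule E) {K : ClassTable} {ws : List Witness}
    (hc : ∀ c ∈ K.classes, ∀ T ∈ c, ∀ T' ∈ c, controlProblem E T ⊆ controlProblem E T')
    (hb : ∀ b ∈ K.below, ∀ T ∈ b.1, ∀ T' ∈ b.2, controlProblem E T ⊆ controlProblem E T')
    (hK : K.Coherent) (hws : K.RefutedBy ws) (hr : ws.all r.check = true)
    (T T' : ControlType) (hne : T ≠ T') (hcomp : Compatible T T') :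
    (K.entry T T').Holds E T T' := by
  have hdiff {T T' : ControlType} (hne : T ≠ T') (hcomp : Compatible T T')
      (hle : K.le T T' = false) : ∃ R, (successSet E T R \ successSet E T' R).Nonempty := by
    obtain ⟨w, hw, hT, hT'⟩ := hws T (mem_allTypes T) T' (mem_allTypes T') hne hcomp hle
    exact r.exists_diff_of_check (List.all_eq_true.1 hr w hw) hT hT'
  have hsub {T T' : ControlType} (hle : K.le T T' = true) :
      controlProblem E T ⊆ controlProblem E T' := ClassTable.subset_of_le hc hb hle
  have hstrict {T T' : ControlType} (hne : T ≠ T') (hcomp : Compatible T T')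
      (hle : K.le T T' = true) (hle' : K.le T' T = false) : StrictlyContained E T T' :=
    ⟨fun R c hc => hsub hle hc, hdiff hne.symm hcomp.symm hle'⟩
  have h := hK T (mem_allTypes T) T' (mem_allTypes T') hne hcomp
  cases he : K.entry T T' <;> rw [he] at h
  · exact Set.Subset.antisymm (hsub h.1) (hsub h.2)
  · refine ⟨fun heq => ?_, hstrict hne hcomp h.1 h.2⟩
    exact not_subset_of_diff (hdiff hne.symm hcomp.symm h.2) heq.symm.subset
  · refine ⟨fun heq => ?_, hstrict hne.symm hcomp.symm h.2 h.1⟩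
    exact not_subset_of_diff (hdiff hne hcomp h.1) heq.subset
  · have h₁ := not_subset_of_diff (hdiff hne hcomp h.1)
    have h₂ := not_subset_of_diff (hdiff hne.symm hcomp.symm h.2)
    refine ⟨fun heq => h₁ heq.subset, fun hs => h₁ ?_, fun hs => h₂ ?_⟩
    · rintro ⟨R, p⟩ hI
      exact hs.1 R hI
    · rintro ⟨R, p⟩ hI
      exact hs.1 R hI

/-! ### Counting pairs -/

/-- The unordered pairs of members of the list whose two members, in the order of the list, are in
the relation `b`. -/
def pairList (b : ControlType → ControlType → Bool) : List ControlType → List (Sym2 ControlType)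
  | [] => []
  | T :: l => (l.filter (b T)).map (fun T' => s(T, T')) ++ pairList b l

theorem mem_pairList {b : ControlType → ControlType → Bool} {z : Sym2 ControlType} :
    ∀ {l : List ControlType}, l.Nodup →
      (∀ T T', T ≠ T' → b T T' = true → b T' T = true) →
      (z ∈ pairList b l ↔ ∃ T ∈ l, ∃ T' ∈ l, T ≠ T' ∧ b T T' = true ∧ z = s(T, T'))
  | [], _, _ => by simp [pairList]
  | S :: l, hl, hb => by
    rw [List.nodup_cons] at hl
    rw [pairList, List.mem_append, mem_pairList hl.2 hb, List.mem_map]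
    constructor
    · rintro (⟨T', hT', rfl⟩ | ⟨T, hT, T', hT', h⟩)
      · rw [List.mem_filter] at hT'
        refine ⟨S, List.mem_cons_self, T', List.mem_cons_of_mem _ hT'.1, ?_, hT'.2, rfl⟩
        rintro rfl
        exact hl.1 hT'.1
      · exact ⟨T, List.mem_cons_of_mem _ hT, T', List.mem_cons_of_mem _ hT', h⟩
    · rintro ⟨T, hT, T', hT', hne, hbT, rfl⟩
      rcases List.mem_cons.1 hT with rfl | hm <;> rcases List.mem_cons.1 hT' with rfl | hm'
      · exact absurd rfl hne
      · exact .inl ⟨T', List.mem_filter.2 ⟨hm', hbT⟩, rfl⟩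
      · exact .inl ⟨T, List.mem_filter.2 ⟨hm, hb _ _ hne hbT⟩, Sym2.eq_swap⟩
      · exact .inr ⟨T, hm, T', hm', hne, hbT, rfl⟩

theorem mem_of_mem_pairList {b : ControlType → ControlType → Bool} {z : Sym2 ControlType}
    {T : ControlType} (hT : T ∈ z) :
    ∀ {l : List ControlType}, z ∈ pairList b l → T ∈ l
  | [], hz => absurd hz List.not_mem_nil
  | S :: l, hz => by
    rw [pairList, List.mem_append, List.mem_map] at hz
    rcases hz with ⟨T', hT', rfl⟩ | hz
    · rcases Sym2.mem_iff.1 hT with rfl | rfl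
      · exact List.mem_cons_self
      · exact List.mem_cons_of_mem _ (List.mem_filter.1 hT').1
    · exact List.mem_cons_of_mem _ (mem_of_mem_pairList hT hz)

theorem nodup_pairList (b : ControlType → ControlType → Bool) :
    ∀ {l : List ControlType}, l.Nodup → (pairList b l).Nodup
  | [], _ => List.nodup_nil
  | S :: l, hl => by
    rw [List.nodup_cons] at hl
    refine List.Nodup.append ?_ (nodup_pairList b hl.2) ?_
    · exact (hl.2.filter _).map fun _ _ h => Sym2.congr_right.1 h
    · intro z hz hz'
      obtain ⟨T', -, rfl⟩ := List.mem_map.1 hz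
      exact hl.1 (mem_of_mem_pairList (Sym2.mem_mk_left S T') hz')

/-- The number of unordered pairs of distinct compatible types in the symmetric relation `b`. -/
def pairCount (b : ControlType → ControlType → Bool) : ℕ :=
  (pairList (fun T T' => decide (Compatible T T') && b T T') allTypes).length

theorem ncard_compatiblePairs {P : ControlType → ControlType → Prop}
    {b : ControlType → ControlType → Bool}
    (h : ∀ T T', T ≠ T' → Compatible T T' → ((P T T' ∨ P T' T) ↔ b T T' = true)) :
    (compatiblePairs P).ncard = pairCount b := by
  have hb : ∀ T T', T ≠ T' → (decide (Compatible T T') && b T T') = true →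
      (decide (Compatible T' T) && b T' T) = true := by
    intro T T' hne hT
    rw [Bool.and_eq_true, decide_eq_true_eq] at hT ⊢
    exact ⟨hT.1.symm, (h T' T hne.symm hT.1.symm).1 ((h T T' hne hT.1).2 hT.2).symm⟩
  have hset : compatiblePairs P = ↑(pairList
      (fun T T' => decide (Compatible T T') && b T T') allTypes).toFinset := by
    ext z
    rw [Finset.mem_coe, List.mem_toFinset, mem_pairList nodup_allTypes hb]
    constructor
    · rintro ⟨T, T', rfl, hne, hc, hP⟩
      refine ⟨T, mem_allTypes T, T', mem_allTypes T', hne, ?_, rfl⟩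
      rw [Bool.and_eq_true, decide_eq_true_eq]
      exact ⟨hc, (h T T' hne hc).1 (.inl hP)⟩
    · rintro ⟨T, -, T', -, hne, hT, rfl⟩
      rw [Bool.and_eq_true, decide_eq_true_eq] at hT
      rcases (h T T' hne hT.1).2 hT.2 with hP | hP
      · exact ⟨T, T', rfl, hne, hT.1, hP⟩
      · exact ⟨T', T, Sym2.eq_swap, hne.symm, hT.1.symm, hP⟩
  rw [hset, Set.ncard_coe_finset, List.toFinset_card_of_nodup (nodup_pairList _ nodup_allTypes),
    pairCount]

theorem StrictlyContained.subset {E : ElectionSystem} {T T' : ControlType}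
    (h : StrictlyContained E T T') : controlProblem E T ⊆ controlProblem E T' := by
  rintro ⟨R, p⟩ hI
  exact h.1 R hI

theorem StrictlyContained.not_subset {E : ElectionSystem} {T T' : ControlType}
    (h : StrictlyContained E T T') : ¬ controlProblem E T' ⊆ controlProblem E T :=
  not_subset_of_diff h.2

theorem collapse_iff_entry {E : ElectionSystem} {e : Entry} {T T' : ControlType}
    (h : e.Holds E T T') :
    Collapse E T T' ↔ e = .collapse := by
  cases e
  · exact ⟨fun _ => rfl, fun _ => h⟩
  · exact ⟨fun h' => absurd h' h.1, fun h' => by cases h'⟩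
  · exact ⟨fun h' => absurd h' h.1, fun h' => by cases h'⟩
  · exact ⟨fun h' => absurd h' h.1, fun h' => by cases h'⟩

theorem strictlyContained_iff_entry {E : ElectionSystem} {e : Entry} {T T' : ControlType}
    (h : e.Holds E T T') :
    StrictlyContained E T T' ∨ StrictlyContained E T' T ↔
      e = .strictSubset ∨ e = .strictSuperset := by
  cases e
  · refine ⟨fun h' => ?_, fun h' => by simp at h'⟩
    rcases h' with h' | h'
    · exact absurd (Eq.subset (Eq.symm h)) h'.not_subset
    · exact absurd (Eq.subset h) h'.not_subset
  · exact ⟨fun _ => .inl rfl, fun _ => .inl h.2⟩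
  · exact ⟨fun _ => .inr rfl, fun _ => .inr h.2⟩
  · exact ⟨fun h' => absurd h' (not_or.2 h.2), fun h' => by simp at h'⟩

theorem incomparable_comm {E : ElectionSystem} {T T' : ControlType} :
    Incomparable E T T' ↔ Incomparable E T' T :=
  ⟨fun h => ⟨h.1.symm, h.2.2, h.2.1⟩, fun h => ⟨h.1.symm, h.2.2, h.2.1⟩⟩

theorem incomparable_iff_entry {E : ElectionSystem} {e : Entry} {T T' : ControlType}
    (h : e.Holds E T T') :
    Incomparable E T T' ↔ e = .incomparable := by
  cases e
  · exact ⟨fun h' => absurd h h'.1, fun h' => by cases h'⟩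
  · exact ⟨fun h' => absurd h.2 h'.2.1, fun h' => by cases h'⟩
  · exact ⟨fun h' => absurd h.2 h'.2.2, fun h' => by cases h'⟩
  · exact ⟨fun _ => rfl, fun _ => h⟩

theorem ncard_collapse {E : ElectionSystem} {K : ClassTable}
    (hK : ∀ T T', T ≠ T' → Compatible T T' → (K.entry T T').Holds E T T') :
    (compatiblePairs (Collapse E)).ncard =
    pairCount (fun T T' => decide (K.entry T T' = .collapse)) := by
  refine ncard_compatiblePairs fun T T' hne hc => ?_
  rw [decide_eq_true_eq, ← collapse_iff_entry (hK T T' hne hc)]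
  exact or_iff_left_of_imp Eq.symm

theorem ncard_separate {E : ElectionSystem} {K : ClassTable}
    (hK : ∀ T T', T ≠ T' → Compatible T T' → (K.entry T T').Holds E T T') :
    (compatiblePairs (Separate E)).ncard =
    pairCount (fun T T' => decide (K.entry T T' ≠ .collapse)) := by
  refine ncard_compatiblePairs fun T T' hne hc => ?_
  rw [decide_eq_true_eq, Ne, ← collapse_iff_entry (hK T T' hne hc)]
  exact or_iff_left_of_imp Ne.symm

theorem ncard_strictlyContained {E : ElectionSystem} {K : ClassTable}
    (hK : ∀ T T', T ≠ T' → Compatible T T' → (K.entry T T').Holds E T T') :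
    (compatiblePairs (StrictlyContained E)).ncard =
    pairCount (fun T T' =>
      decide (K.entry T T' = .strictSubset ∨ K.entry T T' = .strictSuperset)) := by
  refine ncard_compatiblePairs fun T T' hne hc => ?_
  rw [decide_eq_true_eq]
  exact strictlyContained_iff_entry (hK T T' hne hc)

theorem ncard_incomparable {E : ElectionSystem} {K : ClassTable}
    (hK : ∀ T T', T ≠ T' → Compatible T T' → (K.entry T T').Holds E T T') :
    (compatiblePairs (Incomparable E)).ncard =
    pairCount (fun T T' => decide (K.entry T T' = .incomparable)) := by
  refine ncard_compatiblePairs fun T T' hne hc => ?_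
  rw [decide_eq_true_eq, ← incomparable_iff_entry (hK T T' hne hc)]
  exact or_iff_left_of_imp incomparable_comm.1

theorem mainTheorem2 :
    -- there are 322 pairs of distinct compatible control types
    (compatiblePairs (fun _ _ => True)).ncard = 322 ∧
    -- the seven inherited collapses hold for every election system
    (∀ E : ElectionSystem, ∀ c ∈ generalClasses, ∀ T ∈ c, ∀ T' ∈ c, Collapse E T T') ∧
    -- plurality
    (∀ T T' : ControlType, T ≠ T' → Compatible T T' →
      (pluralityTable.entry T T').Holds plurality T T') ∧
    (compatiblePairs (Collapse plurality)).ncard = 7 ∧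
    (compatiblePairs (Separate plurality)).ncard = 315 ∧
    (compatiblePairs (StrictlyContained plurality)).ncard = 38 ∧
    (compatiblePairs (Incomparable plurality)).ncard = 277 ∧
    -- veto
    (∀ T T' : ControlType, T ≠ T' → Compatible T T' →
      (vetoTable.entry T T').Holds veto T T') ∧
    (compatiblePairs (Collapse veto)).ncard = 8 ∧
    (compatiblePairs (Separate veto)).ncard = 314 ∧
    (compatiblePairs (StrictlyContained veto)).ncard = 57 ∧
    (compatiblePairs (Incomparable veto)).ncard = 257 ∧
    -- approval
    (∀ T T' : ControlType, T ≠ T' → Compatible T T' →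
      (approvalTable.entry T T').Holds approval T T') ∧
    (compatiblePairs (Collapse approval)).ncard = 21 ∧
    (compatiblePairs (Separate approval)).ncard = 301 ∧
    (compatiblePairs (StrictlyContained approval)).ncard = 88 ∧
    (compatiblePairs (Incomparable approval)).ncard = 213 := by
  have hP := entry_holds pluralityRule (generalClasses_subset plurality)
    (generalBelow_subset plurality) coherent_plurality refutedBy_plurality check_pluralityWitnesses
  have hV := entry_holds vetoRule vetoTable_classes_subset vetoTable_below_subset coherent_veto
    refutedBy_veto check_vetoWitnesses
  have hA := entry_holds approvalRule approvalTable_classes_subset approvalTable_below_subset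
    coherent_approval refutedBy_approval check_approvalWitnesses
  have hall : (compatiblePairs (fun _ _ => True)).ncard = pairCount (fun _ _ => true) :=
    ncard_compatiblePairs fun _ _ _ _ => by simp
  refine ⟨?_, fun E c hc T hT T' hT' => Set.Subset.antisymm
    (generalClasses_subset E c hc T hT T' hT') (generalClasses_subset E c hc T' hT' T hT),
    hP, ?_, ?_, ?_, ?_, hV, ?_, ?_, ?_, ?_, hA, ?_, ?_, ?_, ?_⟩
  · rw [hall]
    decide +kernel
  · rw [ncard_collapse hP]
    decide +kernel
  · rw [ncard_separate hP]
    decide +kernel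
  · rw [ncard_strictlyContained hP]
    decide +kernel
  · rw [ncard_incomparable hP]
    decide +kernel
  · rw [ncard_collapse hV]
    decide +kernel
  · rw [ncard_separate hV]
    decide +kernel
  · rw [ncard_strictlyContained hV]
    decide +kernel
  · rw [ncard_incomparable hV]
    decide +kernel
  · rw [ncard_collapse hA]
    decide +kernel
  · rw [ncard_separate hA]
    decide +kernel
  · rw [ncard_strictlyContained hA]
    decide +kernel
  · rw [ncard_incomparable hA]
    decide +kernel
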